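/- **Sliding control of the fractional Duffing oscillator.** Let $\alpha\in(0,1)$, $a,b,F\in\mathbb R$ and $c,k,\rho_1,\rho_2>0$. Let $D^\beta y(t)=\frac1{\Gamma(1-\beta)}\int_0^t (t-\tau)^{-\beta}y'(\tau)\,d\tau$ $(0<\beta<1)$ be the Caputo derivative with lower terminal $0$. A motion on $[0,\infty)$ of a second-order equation $\ddot x=g$ is a differentiable $x:[0,\infty)\to\mathbb R$ whose velocity $\dot x$ is locally absolutely continuous and which satisfies the equation for almost every $t\ge 0$; the initial values $x(0),\dot x(0)$ are arbitrary. For a motion write $x_1=x$, $x_2=D^\alpha x$, $x_3=\dot x$, and $$s(t)=x_3(t)+k\int_0^t x_1(\tau)\,d\tau+c\int_0^t x_2(\tau)\,d\tau .$$ Put $\mu_{1-\alpha}(\omega)=\frac{\sin((1-\alpha)\pi)}{\pi}\,\omega^{-(1-\alpha)}$. The infinite state $z(\omega,t)$ $(\omega>0,\ t\ge0)$ of $x$ is the solution of $\partial_t z=-\omega z+\dot x(t)$, $z(\omega,0)=0$. 1. *Sliding dynamics.* Let $x$ be a motion of $\ddot x=-kx-cD^\alpha x$. - For all $t>0$, $D^{1-\alpha}x_2=x_3$.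 The infinite state $z$ of $x$ exists, and for all $t\ge0$, $x_2(t)=\int_0^\infty\mu_{1-\alpha}(\omega)z(\omega,t)\,d\omega$; this integral, $\int_0^\infty\mu_{1-\alpha}z^2d\omega$ and $\int_0^\infty\omega\mu_{1-\alpha}z^2d\omega$ converge absolutely. - The functional $V_5=\frac12kx_1^2+\frac12x_3^2+\frac c2\int_0^\infty\mu_{1-\alpha}(\omega)z^2(\omega,t)\,d\omega$ is differentiable at every $t>0$ with $\dot V_5(t)=-c\int_0^\infty\omega\,\mu_{1-\alpha}(\omega)z^2(\omega,t)\,d\omega$, and this is $<0$ for all $t>0$ if $(x(0),\dot x(0))\ne(0,0)$. - The sliding dynamics are stable: for every $\varepsilon>0$ there is $\delta>0$ such that every motion with $|x(0)|<\delta$, $|\dot x(0)|<\delta$ satisfies $|x_1(t)|,|x_2(t)|,|x_3(t)|<\varepsilon$ for all $t\ge0$. Moreover $x_1(t)\to0$ as $t\to\infty$ for every motion. 2. *Controlled oscillator.* Let $|f(t)|\le F$ for all $t\ge0$, and let $x$ be a motion of $\ddot x+cD^\alpha x+ax+bx^3=f+u$ under the control $$u=bx_1^3+(a-k)x_1+v,\qquad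 v=-\Big(F+\tfrac{\rho_1}{\sqrt2}\Big)\operatorname{sign}(s)-\rho_2 s ,$$ where the switching law is understood in the sense of Filippov: for almost every $t\ge 0$, $v(t)=-(F+\rho_1/\sqrt2)\,\sigma-\rho_2 s(t)$ for some $\sigma$ with $\sigma=1$ if $s(t)>0$, $\sigma=-1$ if $s(t)<0$, and $\sigma\in[-1,1]$ if $s(t)=0$. Then: - $D^{1-\alpha}x_2=x_3$ for all $t>0$; $s$ is locally absolutely continuous, and for almost every $t\ge0$, $\dot s=\dot x_3+kx_1+cx_2=f+v$. - $V_6=\frac12s^2$ satisfies, for almost every $t\ge 0$, $\dot V_6=s(f+v)\le-\rho_1\sqrt{V_6}-2\rho_2V_6$. - $s(t)\to0$ and $x_1(t)\to0$ as $t\to\infty$. -/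

import Mathlib

open MeasureTheory Set Filter Topology

noncomputable section

namespace FracDuffing

/-- The Caputo derivative of order `α ∈ (0, 1)` with lower terminal `0`,
`D^α x (t) = 1 / Γ(1 - α) * ∫₀ᵗ x'(τ) / (t - τ)^α dτ`. -/
def caputo (α : ℝ) (x : ℝ → ℝ) (t : ℝ) : ℝ :=
  1 / Real.Gamma (1 - α) * ∫ τ in (0 : ℝ)..t, deriv x τ / (t - τ) ^ α

/-- The velocity of a motion on `[0, ∞)`; at `t = 0` this is the right derivative. -/
def velocity (x : ℝ → ℝ) (t : ℝ) : ℝ :=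
  derivWithin x (Ici 0) t

/-- `x` is a Carathéodory solution on `[0, ∞)` of `x'' = g`: `x` is differentiable, its velocity
is locally absolutely continuous, and `x''(t) = g t` for almost every `t ≥ 0`. -/
structure HasAcceleration (x g : ℝ → ℝ) : Prop where
  differentiable : DifferentiableOn ℝ x (Ici 0)
  velocity_ac : ∀ T : ℝ, 0 ≤ T → AbsolutelyContinuousOnInterval (velocity x) 0 T
  acceleration : ∀ᵐ t ∂(volume.restrict (Ici (0 : ℝ))), HasDerivAt (velocity x) (g t) t

/-- `x` is a motion on `[0, ∞)` of the controlled fractional Duffing oscillator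
`x'' + c D^α x + a x + b x³ = f + u`. -/
def IsDuffingMotion (α a b c : ℝ) (f u x : ℝ → ℝ) : Prop :=
  HasAcceleration x fun t => -a * x t - b * x t ^ 3 - c * caputo α x t + f t + u t

/-- `x` is a motion on `[0, ∞)` of the sliding dynamics `x'' = -k x - c D^α x`. -/
def IsSlidingMotion (α c k : ℝ) (x : ℝ → ℝ) : Prop :=
  HasAcceleration x fun t => -k * x t - c * caputo α x t

/-- The sliding variable `s = x₃ + k ∫₀ᵗ x₁ + c ∫₀ᵗ x₂` with `x₁ = x`, `x₂ = D^α x`, `x₃ = x'`. -/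
def slidingVar (α c k : ℝ) (x : ℝ → ℝ) (t : ℝ) : ℝ :=
  velocity x t + k * (∫ τ in (0 : ℝ)..t, x τ) + c * ∫ τ in (0 : ℝ)..t, caputo α x τ

/-- The Filippov set-valued sign: `{1}` for `s > 0`, `{-1}` for `s < 0`, `[-1, 1]` for `s = 0`. -/
def filippovSign (s : ℝ) : Set ℝ :=
  if 0 < s then {1} else if s < 0 then {-1} else Icc (-1) 1

theorem sign_mem_filippovSign (s : ℝ) : Real.sign s ∈ filippovSign s := by
  rcases lt_trichotomy s 0 with h | h | h
  · simp [filippovSign, h, h.not_gt, Real.sign_of_neg h]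
  · simp [filippovSign, h]
  · simp [filippovSign, h, Real.sign_of_pos h]

/-- `v` realizes the switching law `v = -(F + ρ₁ / √2) sign(s) - ρ₂ s` along `s`,
in the sense of Filippov. -/
def IsSwitchingControl (F ρ₁ ρ₂ : ℝ) (s v : ℝ → ℝ) : Prop :=
  ∀ᵐ t ∂(volume.restrict (Ici (0 : ℝ))),
    ∃ σ ∈ filippovSign (s t), v t = -(F + ρ₁ / √2) * σ - ρ₂ * s t

/-- The weight `μ_β(ω) = sin(β π) / π * ω^(-β)` of the frequency distributed model. -/
def weight (β ω : ℝ) : ℝ :=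
  Real.sin (β * Real.pi) / Real.pi * ω ^ (-β)

/-- `z` is the infinite state variable of `x`, started from rest:
`∂z/∂t (ω, t) = -ω z(ω, t) + x'(t)` and `z(ω, 0) = 0` for every frequency `ω > 0`. -/
def IsInfiniteState (x : ℝ → ℝ) (z : ℝ → ℝ → ℝ) : Prop :=
  ∀ ω : ℝ, 0 < ω → z ω 0 = 0 ∧
    ∀ t : ℝ, 0 ≤ t → HasDerivWithinAt (z ω) (-ω * z ω t + velocity x t) (Ici 0) t

/-- The diffusive energy
`V₅ = k x₁² / 2 + x₃² / 2 + c / 2 * ∫₀^∞ μ_{1-α}(ω) z(ω, t)² dω`. -/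
def energy (α c k : ℝ) (x : ℝ → ℝ) (z : ℝ → ℝ → ℝ) (t : ℝ) : ℝ :=
  1 / 2 * k * x t ^ 2 + 1 / 2 * velocity x t ^ 2 +
    c / 2 * ∫ ω in Ioi (0 : ℝ), weight (1 - α) ω * z ω t ^ 2

/-- The dissipation integral `∫₀^∞ ω μ_{1-α}(ω) z(ω, t)² dω`. -/
def dissipation (α : ℝ) (z : ℝ → ℝ → ℝ) (t : ℝ) : ℝ :=
  ∫ ω in Ioi (0 : ℝ), ω * weight (1 - α) ω * z ω t ^ 2

/-- The reaching functional `V₆ = s² / 2`. -/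
def reachingEnergy (α c k : ℝ) (x : ℝ → ℝ) (t : ℝ) : ℝ :=
  1 / 2 * slidingVar α c k x t ^ 2

end FracDuffing

end

namespace FracDuffing

/-! ### Riemann–Liouville integrals -/

/-! Everything rests on two descriptions of the Caputo derivative x₂ = I^{1-α} x', where I^a is the
Riemann–Liouville integral.

Semigroup. By Fubini and the Beta integral, I^a I^b = I^{a+b} (`rlIntegral_semigroup`). Since x' =
x'(0) + I¹ x'', x₂ is the primitive of x'(0) t^{-α}/Γ(1-α) + I^{1-α} x''. So x₂ is continuous, and
applying I^α to its derivative returns x' (`caputo_caputo`).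

Diffusion. The kernel t^{-α}/Γ(1-α) is the Laplace transform of the weight μ, hence x₂ = ∫ μ z
(`integral_weight_mul_infState`). A bound |z| ≤ B min(1, 1/ω) dominates all frequency integrals by μ
min(1, 1/ω). Differentiating V₅ under the integral, the coupling terms c x₃ x₂ cancel and only -c ∫
ω μ z² remains. If that vanishes at some t > 0, the finite Laplace transform of x' on [0, t]
vanishes, so x' = 0 there by Weierstrass, and the equation then gives x = 0.

Stability. V₅ is nonincreasing and starts at the mechanical energy, which controls x₁ and x₃; x₂
follows because z is bounded by sup |x| and sup |x'| with no growth in time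
(`abs_infState_le_position`).

Convergence (`HasAcceleration.tendsto_zero`). The dissipation is integrable in time, so for almost
every ω so is z(ω, ·)². Barbalat's lemma is then used three times: z(ω, t) → 0; from z' = -ωz + x',
x' → 0; and, once x₂ → 0 by dominated convergence, x'' = -kx - c x₂ gives x → 0.

Control. The feedback leaves s' = f + v, and the switching gain makes s reach 0 in finite time and
stay there. From that time T on, s' = 0 is the sliding equation. The energy argument needs the
equation only after T, the earlier history being stored in z, so it still gives x → 0. -/

theorem intervalIntegrable_beta {a b : ℝ} (ha : 0 < a) (hb : 0 < b) {t : ℝ} (ht : 0 < t) :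
    IntervalIntegrable (fun u : ℝ => u ^ (b - 1) * (t - u) ^ (a - 1)) volume 0 t ∧
    ∫ u in (0 : ℝ)..t, u ^ (b - 1) * (t - u) ^ (a - 1) =
      t ^ (a + b - 1) * (Real.Gamma a * Real.Gamma b / Real.Gamma (a + b)) := by
  have h1 : ∀ u ∈ Ioc (0 : ℝ) t, ((u ^ (b - 1) * (t - u) ^ (a - 1) : ℝ) : ℂ) =
      (u : ℂ) ^ ((b : ℂ) - 1) * ((t : ℂ) - u) ^ ((a : ℂ) - 1) := by
    intro u hu
    rw [Complex.ofReal_mul, Complex.ofReal_cpow hu.1.le, Complex.ofReal_cpow (sub_nonneg.2 hu.2)]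
    push_cast; rfl
  have h2 := Complex.betaIntegral_scaled b a ht
  have h3 : ∫ u in (0 : ℝ)..t, ((u ^ (b - 1) * (t - u) ^ (a - 1) : ℝ) : ℂ) =
      (t : ℂ) ^ ((b : ℂ) + a - 1) * Complex.betaIntegral b a := by
    rw [← h2]
    refine intervalIntegral.integral_congr_ae (ae_of_all _ fun u hu => h1 u ?_)
    rwa [uIoc_of_le ht.le] at hu
  have hB : Complex.betaIntegral b a =
      ((Real.Gamma a * Real.Gamma b / Real.Gamma (a + b) : ℝ) : ℂ) := by
    rw [Complex.betaIntegral_eq_Gamma_mul_div _ _ (by simpa) (by simpa)]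
    rw [← Complex.ofReal_add, Complex.Gamma_ofReal, Complex.Gamma_ofReal, Complex.Gamma_ofReal,
      add_comm b a]
    push_cast; ring
  have h4 : ∫ u in (0 : ℝ)..t, u ^ (b - 1) * (t - u) ^ (a - 1) =
      t ^ (a + b - 1) * (Real.Gamma a * Real.Gamma b / Real.Gamma (a + b)) := by
    rw [intervalIntegral.integral_ofReal, hB] at h3
    have h5 : (t : ℂ) ^ ((b : ℂ) + a - 1) = ((t ^ (a + b - 1) : ℝ) : ℂ) := by
      rw [Complex.ofReal_cpow ht.le]; push_cast; ring_nf
    rw [h5] at h3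
    exact_mod_cast h3
  refine ⟨?_, h4⟩
  -- A non-integrable function has integral 0 by convention, so the positive value just found forces
  -- integrability.
  by_contra hn
  rw [intervalIntegral.integral_undef hn] at h4
  have : 0 < t ^ (a + b - 1) * (Real.Gamma a * Real.Gamma b / Real.Gamma (a + b)) := by
    have := Real.Gamma_pos_of_pos ha
    have := Real.Gamma_pos_of_pos hb
    have := Real.Gamma_pos_of_pos (add_pos ha hb)
    positivity
  exact this.ne h4

theorem integrableOn_beta_shift {a b : ℝ} (ha : 0 < a) (hb : 0 < b) {r t : ℝ} (hrt : r < t) :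
    IntegrableOn (fun τ : ℝ => (t - τ) ^ (a - 1) * (τ - r) ^ (b - 1)) (Ioc r t) ∧
    ∫ τ in Ioc r t, (t - τ) ^ (a - 1) * (τ - r) ^ (b - 1) =
      (t - r) ^ (a + b - 1) * (Real.Gamma a * Real.Gamma b / Real.Gamma (a + b)) := by
  obtain ⟨h1, h2⟩ := intervalIntegrable_beta ha hb (sub_pos.2 hrt)
  have hfun : (fun τ : ℝ => (t - τ) ^ (a - 1) * (τ - r) ^ (b - 1)) =
      fun τ => (fun u : ℝ => u ^ (b - 1) * (t - r - u) ^ (a - 1)) (τ - r) := by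
    funext τ; simp only [sub_sub_sub_cancel_right]; ring
  constructor
  · have := h1.comp_sub_right r
    rw [zero_add, sub_add_cancel] at this
    rw [← intervalIntegrable_iff_integrableOn_Ioc_of_le hrt.le, hfun]
    exact this
  · rw [← intervalIntegral.integral_of_le hrt.le, hfun,
      intervalIntegral.integral_comp_sub_right
        (fun u : ℝ => u ^ (b - 1) * (t - r - u) ^ (a - 1)) r, sub_self, h2]

/-- The Riemann–Liouville integral of order `a` with lower terminal `0`. -/
noncomputable def rlIntegral (a : ℝ) (g : ℝ → ℝ) (t : ℝ) : ℝ :=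
  1 / Real.Gamma a * ∫ τ in (0 : ℝ)..t, (t - τ) ^ (a - 1) * g τ

theorem rlIntegral_one (g : ℝ → ℝ) (t : ℝ) : rlIntegral 1 g t = ∫ τ in (0 : ℝ)..t, g τ := by
  simp [rlIntegral]

theorem rlIntegral_rpow {a b : ℝ} (ha : 0 < a) (hb : 0 < b) {t : ℝ} (ht : 0 < t) :
    rlIntegral a (fun τ => τ ^ (b - 1) / Real.Gamma b) t = t ^ (a + b - 1) / Real.Gamma (a + b) := by
  have h := (intervalIntegrable_beta ha hb ht).2
  have : ∀ τ : ℝ, (t - τ) ^ (a - 1) * (τ ^ (b - 1) / Real.Gamma b) =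
    (1 / Real.Gamma b) * (τ ^ (b - 1) * (t - τ) ^ (a - 1)) := fun τ => by ring
  simp only [rlIntegral, this]
  rw [intervalIntegral.integral_const_mul, h]
  have := Real.Gamma_pos_of_pos ha
  have := Real.Gamma_pos_of_pos hb
  field_simp

theorem intervalIntegrable_sub_rpow {a : ℝ} (ha : 0 < a) (t : ℝ) :
    IntervalIntegrable (fun τ : ℝ => (t - τ) ^ (a - 1)) volume 0 t := by
  have h := (intervalIntegral.intervalIntegrable_rpow' (a := 0) (b := t)
    (show -1 < a - 1 by linarith)).comp_sub_left t
  rw [sub_zero, sub_self] at h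
  exact h.symm

/-- Fubini on the triangle r < τ ≤ t, with the Beta integral as inner integral. The condition `1 ≤ a
+ b` keeps the resulting kernel (t - r)^(a+b-1) bounded, so that the identity holds at every t for
merely integrable g, not just almost everywhere. -/
theorem rlIntegral_semigroup {a b : ℝ} (ha : 0 < a) (hb : 0 < b) (hab : 1 ≤ a + b) {g : ℝ → ℝ}
    {t : ℝ} (ht : 0 ≤ t) (hg : IntervalIntegrable g volume 0 t) :
    IntervalIntegrable (fun τ => (t - τ) ^ (a - 1) * rlIntegral b g τ) volume 0 t ∧
    rlIntegral a (rlIntegral b g) t = rlIntegral (a + b) g t := by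
  have hga := Real.Gamma_pos_of_pos ha
  have hgb := Real.Gamma_pos_of_pos hb
  have hgab := Real.Gamma_pos_of_pos (add_pos ha hb)
  set μ : Measure ℝ := volume.restrict (Ioc 0 t) with hμ
  have hgi : Integrable g μ := (intervalIntegrable_iff_integrableOn_Ioc_of_le ht).1 hg
  let S : Set (ℝ × ℝ) := {p | p.2 < p.1}
  have hS : MeasurableSet S := measurableSet_lt measurable_snd measurable_fst
  let H : ℝ × ℝ → ℝ := fun p => (t - p.1) ^ (a - 1) * (p.1 - p.2) ^ (b - 1) * g p.2
  let Φ : ℝ × ℝ → ℝ := S.indicator H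
  have hΦm : AEStronglyMeasurable Φ (μ.prod μ) := by
    refine AEStronglyMeasurable.indicator ?_ hS
    refine AEStronglyMeasurable.mul ?_ hgi.1.comp_snd
    exact Measurable.aestronglyMeasurable (by fun_prop)
  have hsl : ∀ r : ℝ, (fun τ => Φ (τ, r)) =
      (Ioi r).indicator fun τ => (t - τ) ^ (a - 1) * (τ - r) ^ (b - 1) * g r := by
    intro r; funext τ
    simp only [Φ, S, H, indicator, mem_ofPred_eq, mem_Ioi]
  have hsl' : ∀ r : ℝ, (fun τ => ‖Φ (τ, r)‖) =ᵐ[μ]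
      (Ioi r).indicator fun τ => (t - τ) ^ (a - 1) * (τ - r) ^ (b - 1) * |g r| := by
    intro r
    filter_upwards [ae_restrict_mem measurableSet_Ioc] with τ hτ
    simp only [Φ, S, H, indicator, mem_ofPred_eq, mem_Ioi]
    split_ifs with h
    · rw [Real.norm_eq_abs, abs_mul, abs_mul, abs_of_nonneg (Real.rpow_nonneg (by linarith [hτ.2]) _),
        abs_of_nonneg (Real.rpow_nonneg (by linarith) _)]
    · simp
  have hres : ∀ r ∈ Ioc 0 t, μ.restrict (Ioi r) = volume.restrict (Ioc r t) := by
    intro r hr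
    rw [hμ, Measure.restrict_restrict measurableSet_Ioi]
    congr 1; ext τ; simp only [mem_inter_iff, mem_Ioi, mem_Ioc]
    constructor
    · rintro ⟨h1, h2, h3⟩; exact ⟨h1, h3⟩
    · rintro ⟨h1, h2⟩; exact ⟨h1, hr.1.trans h1, h2⟩
  -- At r = t the inner interval is empty and the Beta formula is not available; this null set is
  -- discarded next.
  have hint : ∀ r ∈ Ioc 0 t, ∀ c : ℝ, ∫ τ, (Ioi r).indicator
      (fun τ => (t - τ) ^ (a - 1) * (τ - r) ^ (b - 1) * c) τ ∂μ =
      (t - r) ^ (a + b - 1) * (Real.Gamma a * Real.Gamma b / Real.Gamma (a + b)) * c ∨ r = t := by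
    intro r hr c
    rcases hr.2.eq_or_lt with h | h
    · exact Or.inr h
    left
    rw [integral_indicator measurableSet_Ioi, hres r hr, integral_mul_const,
      (integrableOn_beta_shift ha hb h).2]
  have hne : ∀ᵐ r ∂μ, r ∈ Ioo 0 t := by
    rw [hμ, ← restrict_Ioo_eq_restrict_Ioc]; exact ae_restrict_mem measurableSet_Ioo
  have hint' : ∀ c : ℝ → ℝ, (fun r => ∫ τ, (Ioi r).indicator
      (fun τ => (t - τ) ^ (a - 1) * (τ - r) ^ (b - 1) * c r) τ ∂μ) =ᵐ[μ] fun r =>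
      (t - r) ^ (a + b - 1) * (Real.Gamma a * Real.Gamma b / Real.Gamma (a + b)) * c r := by
    intro c
    filter_upwards [hne] with r hr
    exact (hint r ⟨hr.1, hr.2.le⟩ (c r)).resolve_right hr.2.ne
  have hΦ : Integrable Φ (μ.prod μ) := by
    rw [integrable_prod_iff' hΦm]
    constructor
    · filter_upwards [hne] with r hr
      rw [hsl r, integrable_indicator_iff measurableSet_Ioi, IntegrableOn,
        hres r ⟨hr.1, hr.2.le⟩]
      exact (integrableOn_beta_shift ha hb hr.2).1.mul_const _
    · have e : (fun r => ∫ τ, ‖Φ (τ, r)‖ ∂μ) =ᵐ[μ] fun r => (t - r) ^ (a + b - 1) *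
          (Real.Gamma a * Real.Gamma b / Real.Gamma (a + b)) * |g r| := by
        refine EventuallyEq.trans (ae_of_all _ fun r => ?_) (hint' fun r => |g r|)
        exact integral_congr_ae (hsl' r)
      rw [integrable_congr e]
      refine Integrable.bdd_mul (c := t ^ (a + b - 1) *
          (Real.Gamma a * Real.Gamma b / Real.Gamma (a + b))) hgi.abs
        (Measurable.aestronglyMeasurable (by fun_prop)) ?_
      filter_upwards [hne] with r hr
      have h0 : 0 ≤ t - r := by linarith [hr.2]
      rw [Real.norm_of_nonneg (by positivity)]
      gcongr
      linarith [hr.1]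
  have hL : ∀ τ ∈ Ioc 0 t, ∫ r, Φ (τ, r) ∂μ =
      Real.Gamma b * ((t - τ) ^ (a - 1) * rlIntegral b g τ) := by
    intro τ hτ
    have e : (fun r => Φ (τ, r)) =
        (Iio τ).indicator fun r => (t - τ) ^ (a - 1) * ((τ - r) ^ (b - 1) * g r) := by
      funext r
      simp only [Φ, S, H, indicator, mem_ofPred_eq, mem_Iio, mul_assoc]
    have e2 : μ.restrict (Iio τ) = volume.restrict (Ioo 0 τ) := by
      rw [hμ, Measure.restrict_restrict measurableSet_Iio]
      congr 1; ext r; simp only [mem_inter_iff, mem_Iio, mem_Ioc, mem_Ioo]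
      constructor
      · rintro ⟨h1, h2, h3⟩; exact ⟨h2, h1⟩
      · rintro ⟨h1, h2⟩; exact ⟨h2, h1, h2.le.trans hτ.2⟩
    rw [e, integral_indicator measurableSet_Iio, e2, integral_const_mul, rlIntegral,
      intervalIntegral.integral_of_le hτ.1.le, ← integral_Ioc_eq_integral_Ioo]
    field_simp
  have hL' : (fun τ => ∫ r, Φ (τ, r) ∂μ) =ᵐ[μ]
      fun τ => Real.Gamma b * ((t - τ) ^ (a - 1) * rlIntegral b g τ) := by
    filter_upwards [ae_restrict_mem measurableSet_Ioc] with τ hτ using hL τ hτ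
  have hI : Integrable (fun τ => (t - τ) ^ (a - 1) * rlIntegral b g τ) μ := by
    have h1 := (hΦ.integral_prod_left.congr hL').const_mul (Real.Gamma b)⁻¹
    refine h1.congr (ae_of_all _ fun τ => ?_)
    simp only [← mul_assoc, inv_mul_cancel₀ hgb.ne', one_mul]
  refine ⟨(intervalIntegrable_iff_integrableOn_Ioc_of_le ht).2 hI, ?_⟩
  have hsw : ∫ τ, ∫ r, Φ (τ, r) ∂μ ∂μ = ∫ r, ∫ τ, Φ (τ, r) ∂μ ∂μ :=
    integral_integral_swap (f := fun τ r => Φ (τ, r)) hΦ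
  rw [integral_congr_ae hL', integral_const_mul] at hsw
  have hR : ∫ r, ∫ τ, Φ (τ, r) ∂μ ∂μ = (Real.Gamma a * Real.Gamma b / Real.Gamma (a + b)) *
      ∫ r in Ioc 0 t, (t - r) ^ (a + b - 1) * g r := by
    rw [← integral_const_mul]
    refine integral_congr_ae (EventuallyEq.trans (ae_of_all _ fun r => ?_)
      ((hint' g).trans (ae_of_all _ fun r => ?_)))
    · simp only [hsl r]
    · ring
  rw [hR] at hsw
  rw [rlIntegral, rlIntegral, intervalIntegral.integral_of_le ht, intervalIntegral.integral_of_le ht]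
  have : ∫ τ, (t - τ) ^ (a - 1) * rlIntegral b g τ ∂μ = Real.Gamma a / Real.Gamma (a + b) *
      ∫ r in Ioc 0 t, (t - r) ^ (a + b - 1) * g r := by
    apply mul_left_cancel₀ hgb.ne'
    rw [hsw]; ring
  rw [this]
  field_simp

theorem rlIntegral_congr {a t : ℝ} {f g : ℝ → ℝ} (ht : 0 ≤ t)
    (h : ∀ᵐ τ, τ ∈ Ioc 0 t → f τ = g τ) : rlIntegral a f t = rlIntegral a g t := by
  unfold rlIntegral
  congr 1
  refine intervalIntegral.integral_congr_ae ?_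
  filter_upwards [h] with τ hτ h1
  rw [uIoc_of_le ht] at h1
  rw [hτ h1]

theorem rlIntegral_const_mul_add {a t : ℝ} {f g : ℝ → ℝ} (c : ℝ)
    (hf : IntervalIntegrable (fun τ => (t - τ) ^ (a - 1) * f τ) volume 0 t)
    (hg : IntervalIntegrable (fun τ => (t - τ) ^ (a - 1) * g τ) volume 0 t) :
    rlIntegral a (fun τ => c * f τ + g τ) t = c * rlIntegral a f t + rlIntegral a g t := by
  unfold rlIntegral
  have : (fun τ => (t - τ) ^ (a - 1) * (c * f τ + g τ)) =
      fun τ => c * ((t - τ) ^ (a - 1) * f τ) + (t - τ) ^ (a - 1) * g τ := by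
    funext τ; ring
  rw [this, intervalIntegral.integral_add (hf.const_mul c) hg, intervalIntegral.integral_const_mul]
  ring

theorem intervalIntegrable_sub_rpow_mul_rpow {a b : ℝ} (ha : 0 < a) (hb : 0 < b) {t : ℝ}
    (ht : 0 < t) :
    IntervalIntegrable (fun τ => (t - τ) ^ (a - 1) * (τ ^ (b - 1) / Real.Gamma b)) volume 0 t := by
  have := (intervalIntegrable_beta ha hb ht).1.const_mul (1 / Real.Gamma b)
  exact this.congr fun τ _ => by ring

theorem continuousOn_Ici_of_absolutelyContinuous {f : ℝ → ℝ}
    (hf : ∀ T, 0 ≤ T → AbsolutelyContinuousOnInterval f 0 T) : ContinuousOn f (Ici 0) := by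
  intro t ht
  have ht1 : (0 : ℝ) ≤ t + 1 := by linarith [mem_Ici.1 ht]
  have h1 := (hf (t + 1) ht1).continuousOn
  rw [uIcc_of_le ht1] at h1
  refine (h1 t ⟨ht, by linarith⟩).mono_of_mem_nhdsWithin ?_
  exact mem_nhdsWithin.2 ⟨Iio (t + 1), isOpen_Iio, by simp, fun y hy => ⟨hy.2, le_of_lt hy.1⟩⟩

/-! ### Motions and their Caputo derivatives -/

namespace HasAcceleration

variable {x g : ℝ → ℝ}

theorem hasDerivWithinAt (h : HasAcceleration x g) {t : ℝ} (ht : 0 ≤ t) :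
    HasDerivWithinAt x (velocity x t) (Ici 0) t :=
  (h.differentiable t ht).hasDerivWithinAt

theorem hasDerivAt (h : HasAcceleration x g) {t : ℝ} (ht : 0 < t) :
    HasDerivAt x (velocity x t) t :=
  (h.hasDerivWithinAt ht.le).hasDerivAt (Ici_mem_nhds ht)

theorem continuousOn (h : HasAcceleration x g) : ContinuousOn x (Ici 0) :=
  h.differentiable.continuousOn

theorem continuousOn_velocity (h : HasAcceleration x g) : ContinuousOn (velocity x) (Ici 0) :=
  continuousOn_Ici_of_absolutelyContinuous h.velocity_ac

theorem intervalIntegrable_deriv_velocity (h : HasAcceleration x g) {t : ℝ} (ht : 0 ≤ t) :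
    IntervalIntegrable (deriv (velocity x)) volume 0 t :=
  (h.velocity_ac t ht).intervalIntegrable_deriv

theorem velocity_eq (h : HasAcceleration x g) {t : ℝ} (ht : 0 ≤ t) :
    velocity x t = velocity x 0 + ∫ τ in (0 : ℝ)..t, deriv (velocity x) τ := by
  rw [(h.velocity_ac t ht).integral_deriv_eq_sub]; ring

theorem deriv_velocity (h : HasAcceleration x g) :
    ∀ᵐ t ∂(volume.restrict (Ici (0 : ℝ))), deriv (velocity x) t = g t := by
  filter_upwards [h.acceleration] with t ht using ht.deriv

theorem caputo_eq_rlIntegral (h : HasAcceleration x g) (α : ℝ) {t : ℝ} (ht : 0 ≤ t) :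
    caputo α x t = rlIntegral (1 - α) (velocity x) t := by
  unfold caputo rlIntegral
  congr 1
  refine intervalIntegral.integral_congr_ae (ae_of_all _ fun τ hτ => ?_)
  rw [uIoc_of_le ht] at hτ
  rw [(h.hasDerivAt hτ.1).deriv, show 1 - α - 1 = -α by ring,
    Real.rpow_neg (by linarith [hτ.2])]
  ring

variable {α : ℝ}

/-- The Caputo derivative of a motion is the primitive of the Riemann–Liouville derivative of the
velocity. -/
theorem caputo_eq_integral (h : HasAcceleration x g) (hα₁ : α < 1) {t : ℝ}
    (ht : 0 ≤ t) :
    IntervalIntegrable (fun τ => velocity x 0 * (τ ^ (1 - α - 1) / Real.Gamma (1 - α)) +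
      rlIntegral (1 - α) (deriv (velocity x)) τ) volume 0 t ∧
    caputo α x t = ∫ τ in (0 : ℝ)..t,
      (velocity x 0 * (τ ^ (1 - α - 1) / Real.Gamma (1 - α)) +
        rlIntegral (1 - α) (deriv (velocity x)) τ) := by
  rcases ht.eq_or_lt with rfl | ht'
  · simp [caputo]
  have hg := h.intervalIntegrable_deriv_velocity ht
  have h1α : 0 < 1 - α := by linarith
  -- Both orders of composition, I¹ I^{1-α} and I^{1-α} I¹, equal the integral of order 2 - α;
  -- comparing them moves the primitive outside.
  have s1 := rlIntegral_semigroup one_pos h1α (by linarith) ht hg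
  have s2 := rlIntegral_semigroup h1α one_pos (by linarith) ht hg
  have b1 := intervalIntegrable_sub_rpow_mul_rpow one_pos h1α ht'
  have b2 := intervalIntegrable_sub_rpow_mul_rpow h1α one_pos ht'
  have i1 := (b1.const_mul (velocity x 0)).add s1.1
  constructor
  · exact i1.congr fun τ _ => by simp
  · rw [h.caputo_eq_rlIntegral α ht, ← rlIntegral_one, rlIntegral_const_mul_add _ b1 s1.1,
      rlIntegral_rpow one_pos h1α ht', s1.2]
    have : rlIntegral (1 - α) (velocity x) t = rlIntegral (1 - α)
      (fun τ => velocity x 0 * (τ ^ ((1 : ℝ) - 1) / Real.Gamma 1) +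
        rlIntegral 1 (deriv (velocity x)) τ) t := by
      refine rlIntegral_congr ht (ae_of_all _ fun τ hτ => ?_)
      rw [rlIntegral_one, h.velocity_eq hτ.1.le]
      simp
    rw [this, rlIntegral_const_mul_add _ b2 s2.1, rlIntegral_rpow h1α one_pos ht', s2.2,
      add_comm 1 (1 - α)]

theorem continuousOn_caputo (h : HasAcceleration x g) (hα₁ : α < 1) :
    ContinuousOn (caputo α x) (Ici 0) := by
  intro t ht
  have ht1 : (0 : ℝ) ≤ t + 1 := by linarith [mem_Ici.1 ht]
  have h1 := (h.caputo_eq_integral hα₁ ht1).1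
  have h2 := intervalIntegral.continuousOn_primitive_interval' h1 left_mem_uIcc
  rw [uIcc_of_le ht1] at h2
  have h3 : ContinuousOn (caputo α x) (Icc 0 (t + 1)) :=
    h2.congr fun s hs => (h.caputo_eq_integral hα₁ hs.1).2
  refine (h3 t ⟨ht, by linarith⟩).mono_of_mem_nhdsWithin ?_
  exact mem_nhdsWithin.2 ⟨Iio (t + 1), isOpen_Iio, by simp, fun y hy => ⟨hy.2, le_of_lt hy.1⟩⟩

/-- The complementary Caputo derivative of the Caputo derivative recovers the velocity. -/
theorem caputo_caputo (h : HasAcceleration x g) (hα₀ : 0 < α) (hα₁ : α < 1) {t : ℝ}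
    (ht : 0 < t) : caputo (1 - α) (caputo α x) t = velocity x t := by
  have h1α : 0 < 1 - α := by linarith
  have hg := h.intervalIntegrable_deriv_velocity ht.le
  have s1 := rlIntegral_semigroup hα₀ h1α (by linarith) ht.le hg
  have b1 := intervalIntegrable_sub_rpow_mul_rpow hα₀ h1α ht
  have e1 : caputo (1 - α) (caputo α x) t = rlIntegral α
      (fun τ => velocity x 0 * (τ ^ (1 - α - 1) / Real.Gamma (1 - α)) +
        rlIntegral (1 - α) (deriv (velocity x)) τ) t := by
    rw [caputo, rlIntegral, sub_sub_cancel]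
    congr 1
    refine intervalIntegral.integral_congr_ae ?_
    -- Lebesgue differentiation: the integrand of the primitive is the derivative of x₂ almost
    -- everywhere, which is enough under the integral.
    have hd := (h.caputo_eq_integral hα₁ ht.le).1.ae_hasDerivAt_integral
    filter_upwards [hd] with τ hτ hm
    have hm' := uIoc_subset_uIcc hm
    rw [uIoc_of_le ht.le] at hm
    have hτ' := hτ hm' 0 left_mem_uIcc
    have : deriv (caputo α x) τ = velocity x 0 * (τ ^ (1 - α - 1) / Real.Gamma (1 - α)) +
        rlIntegral (1 - α) (deriv (velocity x)) τ := by
      refine (hτ'.congr_of_eventuallyEq ?_).deriv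
      filter_upwards [Ioi_mem_nhds hm.1] with s hs
      exact (h.caputo_eq_integral hα₁ (le_of_lt hs)).2
    rw [this, show α - 1 = -(1 - α) by ring, Real.rpow_neg (by linarith [hm.2])]
    ring
  rw [e1, rlIntegral_const_mul_add _ b1 s1.1, rlIntegral_rpow hα₀ h1α ht, s1.2,
    add_sub_cancel, rlIntegral_one, h.velocity_eq ht.le]
  simp

end HasAcceleration

/-! ### The infinite state -/

/-- The solution of `∂z/∂t = -ω z + V`, `z(ω, 0) = 0`, by variation of constants. -/
noncomputable def infState (V : ℝ → ℝ) (ω t : ℝ) : ℝ :=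
  ∫ τ in (0 : ℝ)..t, Real.exp (-(ω * (t - τ))) * V τ

section InfState

variable {V : ℝ → ℝ}

theorem infState_zero (V : ℝ → ℝ) (ω : ℝ) : infState V ω 0 = 0 := by simp [infState]

/-- Removes t from the integrand, so that continuity in (ω, t) and the fundamental theorem of
calculus apply directly. -/
theorem infState_eq_exp_mul (V : ℝ → ℝ) (ω t : ℝ) :
    infState V ω t = Real.exp (-(ω * t)) * ∫ τ in (0 : ℝ)..t, Real.exp (ω * τ) * V τ := by
  rw [infState, ← intervalIntegral.integral_const_mul]
  refine intervalIntegral.integral_congr fun τ _ => ?_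
  simp only [← mul_assoc, ← Real.exp_add]
  ring_nf

theorem continuous_infState (hV : Continuous V) :
    Continuous fun p : ℝ × ℝ => infState V p.1 p.2 := by
  have h1 : Continuous fun p : ℝ × ℝ => ∫ τ in (0 : ℝ)..p.2, Real.exp (p.1 * τ) * V τ := by
    refine intervalIntegral.continuous_parametric_intervalIntegral_of_continuous
      (f := fun (p : ℝ × ℝ) τ => Real.exp (p.1 * τ) * V τ) ?_ continuous_snd
    simp only [Function.uncurry_def]
    fun_prop
  simp only [infState_eq_exp_mul]
  fun_prop

theorem hasDerivAt_infState (hV : Continuous V) (ω t : ℝ) :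
    HasDerivAt (infState V ω) (-ω * infState V ω t + V t) t := by
  have h1 : HasDerivAt (fun t => ∫ τ in (0 : ℝ)..t, Real.exp (ω * τ) * V τ)
      (Real.exp (ω * t) * V t) t :=
    (show Continuous fun τ => Real.exp (ω * τ) * V τ by fun_prop).integral_hasStrictDerivAt 0 t
      |>.hasDerivAt
  have h2 : HasDerivAt (fun t => Real.exp (-(ω * t))) (Real.exp (-(ω * t)) * -(ω * 1)) t :=
    (((hasDerivAt_id t).const_mul ω).neg).exp
  have h3 := h2.mul h1
  have e : infState V ω = fun t => Real.exp (-(ω * t)) *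
      ∫ τ in (0 : ℝ)..t, Real.exp (ω * τ) * V τ := funext (infState_eq_exp_mul V ω)
  rw [e]
  refine h3.congr_deriv ?_
  have : Real.exp (-(ω * t)) * (Real.exp (ω * t) * V t) = V t := by
    rw [← mul_assoc, ← Real.exp_add]; simp
  rw [this]
  ring

/-- The integrating factor exp(ωt) makes the difference of two solutions constant. The initial value
is left free because the formula is also applied to z - x, which does not start at 0. -/
theorem eq_infState_of_hasDerivWithinAt (hV : Continuous V) {ω : ℝ} {z : ℝ → ℝ}
    (hz : ∀ t : ℝ, 0 ≤ t → HasDerivWithinAt z (-ω * z t + V t) (Ici 0) t) {t : ℝ} (ht : 0 ≤ t) :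
    z t = Real.exp (-(ω * t)) * z 0 + infState V ω t := by
  let d : ℝ → ℝ := fun s => Real.exp (ω * s) * (z s - infState V ω s)
  have hd : ∀ s : ℝ, 0 ≤ s → HasDerivWithinAt d 0 (Ici 0) s := by
    intro s hs
    have h2 : HasDerivAt (fun t => Real.exp (ω * t)) (Real.exp (ω * s) * (ω * 1)) s :=
      ((hasDerivAt_id s).const_mul ω).exp
    refine (h2.hasDerivWithinAt.mul
      ((hz s hs).sub (hasDerivAt_infState hV ω s).hasDerivWithinAt)).congr_deriv ?_
    simp only [Pi.sub_apply]
    ring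
  have h0 : d t = d 0 := by
    refine constant_of_has_deriv_right_zero (a := 0) (b := t) ?_ ?_ t ⟨ht, le_rfl⟩
    · exact fun s hs => ((hd s hs.1).continuousWithinAt).mono fun y hy => hy.1
    · exact fun s hs => (hd s hs.1).mono (Ici_subset_Ici.2 hs.1)
  simp only [d, infState_zero, mul_zero, Real.exp_zero, sub_zero, one_mul] at h0
  rw [← h0, ← mul_assoc, ← Real.exp_add]
  simp

theorem integral_exp_neg_mul_sub {ω : ℝ} (hω : 0 < ω) (t : ℝ) :
    ∫ τ in (0 : ℝ)..t, Real.exp (-(ω * (t - τ))) = (1 - Real.exp (-(ω * t))) / ω := by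
  have h : ∀ τ ∈ uIcc 0 t, HasDerivAt (fun τ => Real.exp (-(ω * (t - τ))) / ω)
      (Real.exp (-(ω * (t - τ)))) τ := by
    intro τ _
    have h1 : HasDerivAt (fun τ => Real.exp (-(ω * (t - τ))))
        (Real.exp (-(ω * (t - τ))) * -(ω * -1)) τ :=
      (((hasDerivAt_id τ).const_sub t).const_mul ω).neg.exp
    refine (h1.div_const ω).congr_deriv ?_
    field_simp
  rw [intervalIntegral.integral_eq_sub_of_hasDerivAt h
    (Continuous.intervalIntegrable (by fun_prop) _ _)]
  simp
  ring

theorem abs_infState_le {ω t M : ℝ} (hω : 0 < ω) (ht : 0 ≤ t)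
    (hM : ∀ τ ∈ Icc 0 t, |V τ| ≤ M) :
    |infState V ω t| ≤ (1 - Real.exp (-(ω * t))) / ω * M := by
  rw [← integral_exp_neg_mul_sub hω, infState, ← intervalIntegral.integral_mul_const,
    ← Real.norm_eq_abs]
  refine intervalIntegral.norm_integral_le_of_norm_le ht (ae_of_all _ fun τ hτ => ?_)
    (Continuous.intervalIntegrable (by fun_prop) _ _)
  rw [norm_mul, Real.norm_of_nonneg (Real.exp_pos _).le]
  gcongr
  exact hM τ ⟨hτ.1.le, hτ.2⟩

theorem abs_infState_le_div {ω t M : ℝ} (hω : 0 < ω) (ht : 0 ≤ t)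
    (hM : ∀ τ ∈ Icc 0 t, |V τ| ≤ M) : |infState V ω t| ≤ M / ω := by
  have hM0 : 0 ≤ M := (abs_nonneg _).trans (hM 0 ⟨le_rfl, ht⟩)
  refine (abs_infState_le hω ht hM).trans ?_
  rw [div_mul_eq_mul_div]
  gcongr
  nlinarith [Real.exp_pos (-(ω * t))]

theorem abs_infState_le_mul {ω t M : ℝ} (hω : 0 < ω) (ht : 0 ≤ t)
    (hM : ∀ τ ∈ Icc 0 t, |V τ| ≤ M) : |infState V ω t| ≤ t * M := by
  have hM0 : 0 ≤ M := (abs_nonneg _).trans (hM 0 ⟨le_rfl, ht⟩)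
  refine (abs_infState_le hω ht hM).trans ?_
  gcongr
  rw [div_le_iff₀ hω]
  nlinarith [Real.add_one_le_exp (-(ω * t))]

/-- The bound tM serves low frequencies and M/ω high ones; the factor T + 1 covers both. -/
theorem abs_infState_le_min {ω t T M : ℝ} (hω : 0 < ω) (ht : 0 ≤ t)
    (htT : t ≤ T) (hM : ∀ τ ∈ Icc 0 T, |V τ| ≤ M) :
    |infState V ω t| ≤ (T + 1) * M * min 1 (1 / ω) := by
  have hM0 : 0 ≤ M := (abs_nonneg _).trans (hM 0 ⟨le_rfl, ht.trans htT⟩)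
  have hM' : ∀ τ ∈ Icc 0 t, |V τ| ≤ M := fun τ hτ => hM τ ⟨hτ.1, hτ.2.trans htT⟩
  have hT : 0 ≤ T := ht.trans htT
  rw [mul_min_of_nonneg _ _ (by positivity)]
  refine le_min ?_ ?_
  · refine (abs_infState_le_mul hω ht hM').trans ?_
    nlinarith
  · refine (abs_infState_le_div hω ht hM').trans ?_
    rw [mul_one_div]
    gcongr
    nlinarith

/-- The infinite state is bounded by the position and the velocity, uniformly in time. -/
theorem abs_infState_le_position (hV : Continuous V) {x : ℝ → ℝ} {ω t X M : ℝ} (hω : 0 < ω)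
    (ht : 0 ≤ t) (hxc : ContinuousOn x (Ici 0))
    (hx : ∀ s : ℝ, 0 ≤ s → HasDerivWithinAt x (V s) (Ici 0) s)
    (hX : ∀ τ ∈ Icc 0 t, |x τ| ≤ X) (hM : ∀ τ ∈ Icc 0 t, |V τ| ≤ M) :
    |infState V ω t| ≤ (3 * X + M) * min 1 (1 / ω) := by
  have hM0 : 0 ≤ M := (abs_nonneg _).trans (hM 0 ⟨le_rfl, ht⟩)
  have hX0 : 0 ≤ X := (abs_nonneg _).trans (hX 0 ⟨le_rfl, ht⟩)
  rw [mul_min_of_nonneg _ _ (by positivity)]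
  refine le_min ?_ ?_
  -- The difference z - x satisfies w' = -ωw - ωx. Its forcing has size ωX, so its response is at
  -- most X for every ω and t. The three contributions x(t), exp(-ωt) x(0) and this response give
  -- 3X.
  · let W : ℝ → ℝ := fun s => -(ω * x (max s 0))
    have hW : Continuous W := by
      have : Continuous fun s : ℝ => x (max s 0) :=
        hxc.comp_continuous (by fun_prop) fun s => mem_Ici.2 (le_max_right _ _)
      exact (this.const_mul ω).neg
    have h1 := eq_infState_of_hasDerivWithinAt (ω := ω) (z := fun s => infState V ω s - x s) hW
      (fun s hs => by
        refine ((hasDerivAt_infState hV ω s).hasDerivWithinAt.sub (hx s hs)).congr_deriv ?_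
        simp only [W, max_eq_left hs]; ring) ht
    simp only [infState_zero, zero_sub] at h1
    have h2 := abs_infState_le_div (V := W) hω ht (M := ω * X) (fun τ hτ => by
      simp only [W, abs_neg, abs_mul, max_eq_left hτ.1, abs_of_pos hω]
      gcongr
      exact hX τ hτ)
    rw [mul_div_cancel_left₀ _ hω.ne'] at h2
    have h3 : infState V ω t = x t + (Real.exp (-(ω * t)) * -x 0 + infState W ω t) := by
      rw [← h1]; ring
    have h4 : |Real.exp (-(ω * t)) * -x 0| ≤ X := by
      rw [abs_mul, abs_neg, abs_of_pos (Real.exp_pos _)]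
      have := hX 0 ⟨le_rfl, ht⟩
      have h5 : Real.exp (-(ω * t)) ≤ 1 := Real.exp_le_one_iff.2 (by nlinarith)
      nlinarith [abs_nonneg (x 0)]
    rw [h3]
    have h6 := hX t ⟨ht, le_rfl⟩
    have h7 := abs_add_le (x t) (Real.exp (-(ω * t)) * -x 0 + infState W ω t)
    have h8 := abs_add_le (Real.exp (-(ω * t)) * -x 0) (infState W ω t)
    linarith
  · refine (abs_infState_le_div hω ht hM).trans ?_
    rw [mul_one_div]
    gcongr
    linarith

end InfState

/-! ### Integrals against the weight -/

section Weight

variable {α : ℝ}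

theorem sin_one_sub_mul_pi_pos (hα₀ : 0 < α) (hα₁ : α < 1) :
    0 < Real.sin ((1 - α) * Real.pi) :=
  Real.sin_pos_of_pos_of_lt_pi (mul_pos (by linarith) Real.pi_pos) (by nlinarith [Real.pi_pos])

theorem weight_pos (hα₀ : 0 < α) (hα₁ : α < 1) {ω : ℝ} (hω : 0 < ω) : 0 < weight (1 - α) ω := by
  have := sin_one_sub_mul_pi_pos hα₀ hα₁
  have := Real.pi_pos
  unfold weight
  positivity

theorem measurable_weight (β : ℝ) : Measurable (weight β) := by
  unfold weight
  fun_prop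

/-- The integrand behaves like ω^(α-1) at 0 and ω^(α-2) at infinity, integrable for α > 0 and α < 1
respectively. It is the common dominating function for all frequency integrals. -/
theorem integrableOn_weight_mul_min (hα₀ : 0 < α) (hα₁ : α < 1) :
    IntegrableOn (fun ω => weight (1 - α) ω * min 1 (1 / ω)) (Ioi 0) := by
  have h1 : IntegrableOn (fun ω : ℝ => ω ^ (-(1 - α)) * min 1 (1 / ω)) (Ioc 0 1) := by
    have : IntegrableOn (fun ω : ℝ => ω ^ (-(1 - α))) (Ioc 0 1) :=
      (intervalIntegrable_iff_integrableOn_Ioc_of_le zero_le_one).1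
        (intervalIntegral.intervalIntegrable_rpow' (by linarith))
    refine this.congr_fun (fun ω hω => ?_) measurableSet_Ioc
    have : 1 ≤ 1 / ω := by rw [le_div_iff₀ hω.1]; linarith [hω.2]
    simp only [min_eq_left this, mul_one]
  have h2 : IntegrableOn (fun ω : ℝ => ω ^ (-(1 - α)) * min 1 (1 / ω)) (Ioi 1) := by
    have : IntegrableOn (fun ω : ℝ => ω ^ (-(1 - α) - 1)) (Ioi 1) :=
      integrableOn_Ioi_rpow_of_lt (by linarith) one_pos
    refine this.congr_fun (fun ω hω => ?_) measurableSet_Ioi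
    have hω' : (1 : ℝ) < ω := hω
    have : 1 / ω ≤ 1 := by rw [div_le_iff₀ (by linarith)]; linarith
    simp only [min_eq_right this]
    rw [Real.rpow_sub_one (by linarith), mul_one_div]
  have h3 := (h1.union h2).const_mul (Real.sin ((1 - α) * Real.pi) / Real.pi)
  rw [Ioc_union_Ioi_eq_Ioi zero_le_one] at h3
  refine h3.congr (ae_of_all _ fun ω => ?_)
  simp only [weight]
  ring

theorem min_one_one_div_bounds {ω : ℝ} (hω : 0 < ω) :
    0 ≤ min 1 (1 / ω) ∧ min 1 (1 / ω) ≤ 1 ∧ ω * min 1 (1 / ω) ≤ 1 := by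
  have h1 : 0 ≤ min 1 (1 / ω) := le_min zero_le_one (by positivity)
  refine ⟨h1, min_le_left _ _, ?_⟩
  calc ω * min 1 (1 / ω) ≤ ω * (1 / ω) := by gcongr; exact min_le_right _ _
    _ = 1 := by field_simp

theorem abs_weight_mul_le (hα₀ : 0 < α) (hα₁ : α < 1) {ω y B : ℝ} (hω : 0 < ω)
    (hy : |y| ≤ B * min 1 (1 / ω)) :
    ‖weight (1 - α) ω * y‖ ≤ B * (weight (1 - α) ω * min 1 (1 / ω)) := by
  have := weight_pos hα₀ hα₁ hω
  rw [Real.norm_eq_abs, abs_mul, abs_of_pos this]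
  nlinarith

theorem integrableOn_weight_mul (hα₀ : 0 < α) (hα₁ : α < 1) {y : ℝ → ℝ} {B : ℝ}
    (hm : AEStronglyMeasurable y (volume.restrict (Ioi 0)))
    (hy : ∀ ω : ℝ, 0 < ω → |y ω| ≤ B * min 1 (1 / ω)) :
    IntegrableOn (fun ω => weight (1 - α) ω * y ω) (Ioi 0) := by
  refine ((integrableOn_weight_mul_min hα₀ hα₁).const_mul B).mono'
    ((measurable_weight _).aestronglyMeasurable.mul hm) ?_
  filter_upwards [ae_restrict_mem measurableSet_Ioi] with ω hω
  exact abs_weight_mul_le hα₀ hα₁ hω (hy ω hω)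

/-- Of the two factors min(1, 1/ω) in the square, one is kept and the other absorbs 1 or ω. -/
theorem abs_sq_le_min {ω y B : ℝ} (hω : 0 < ω) (hy : |y| ≤ B * min 1 (1 / ω)) :
    |y ^ 2| ≤ B ^ 2 * min 1 (1 / ω) ∧ |ω * y ^ 2| ≤ B ^ 2 * min 1 (1 / ω) := by
  obtain ⟨h0, h1, h2⟩ := min_one_one_div_bounds hω
  have h3 : y ^ 2 ≤ B ^ 2 * (min 1 (1 / ω)) ^ 2 := by
    rw [← mul_pow, ← sq_abs y]
    gcongr
  constructor
  · rw [abs_of_nonneg (by positivity)]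
    refine h3.trans ?_
    rw [sq (min 1 (1 / ω))]
    gcongr
    nlinarith
  · rw [abs_of_nonneg (by positivity)]
    calc ω * y ^ 2 ≤ ω * (B ^ 2 * (min 1 (1 / ω)) ^ 2) := by gcongr
      _ = B ^ 2 * (ω * min 1 (1 / ω)) * min 1 (1 / ω) := by ring
      _ ≤ B ^ 2 * 1 * min 1 (1 / ω) := by gcongr
      _ = _ := by ring

theorem sin_mul_Gamma (hα₀ : 0 < α) (hα₁ : α < 1) :
    Real.sin ((1 - α) * Real.pi) / Real.pi * Real.Gamma α * Real.Gamma (1 - α) = 1 := by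
  have h := sin_one_sub_mul_pi_pos hα₀ hα₁
  have e : Real.sin (Real.pi * α) = Real.sin ((1 - α) * Real.pi) := by
    rw [← Real.sin_pi_sub]; ring_nf
  rw [mul_assoc, Real.Gamma_mul_Gamma_one_sub, e]
  have := Real.pi_pos
  field_simp

/-- The Laplace transform of the weight. -/
theorem integral_weight_mul_exp (hα₀ : 0 < α) (hα₁ : α < 1) {r : ℝ} (hr : 0 < r) :
    IntegrableOn (fun ω => weight (1 - α) ω * Real.exp (-(ω * r))) (Ioi 0) ∧
    ∫ ω in Ioi (0 : ℝ), weight (1 - α) ω * Real.exp (-(ω * r)) =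
      1 / Real.Gamma (1 - α) * r ^ (-α) := by
  have hΓ := Real.Gamma_pos_of_pos hα₀
  have hΓ' := Real.Gamma_pos_of_pos (show 0 < 1 - α by linarith)
  have h := Real.integral_rpow_mul_exp_neg_mul_Ioi hα₀ hr
  have e : ∀ ω : ℝ, weight (1 - α) ω * Real.exp (-(ω * r)) =
      Real.sin ((1 - α) * Real.pi) / Real.pi * (ω ^ (α - 1) * Real.exp (-(r * ω))) := by
    intro ω
    rw [weight, neg_sub, mul_comm ω r, mul_assoc]
  have h2 : ∫ ω in Ioi (0 : ℝ), weight (1 - α) ω * Real.exp (-(ω * r)) =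
      1 / Real.Gamma (1 - α) * r ^ (-α) := by
    simp only [e]
    rw [integral_const_mul, h]
    rw [← eq_div_of_mul_eq hΓ'.ne' (sin_mul_Gamma hα₀ hα₁), one_div, Real.inv_rpow hr.le,
      ← Real.rpow_neg hr.le]
    ring
  refine ⟨?_, h2⟩
  by_contra hn
  rw [IntegrableOn] at hn
  rw [integral_undef hn] at h2
  have : 0 < 1 / Real.Gamma (1 - α) * r ^ (-α) := by positivity
  exact this.ne h2

/-- The frequency distributed representation of the fractional integral of order `1 - α`. -/
theorem integral_weight_mul_infState (hα₀ : 0 < α) (hα₁ : α < 1) {V : ℝ → ℝ} (hV : Continuous V)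
    {t : ℝ} (ht : 0 ≤ t) :
    ∫ ω in Ioi (0 : ℝ), weight (1 - α) ω * infState V ω t = rlIntegral (1 - α) V t := by
  set μ : Measure ℝ := volume.restrict (Ioi 0) with hμ
  set ν : Measure ℝ := volume.restrict (Ioc 0 t) with hν
  let Φ : ℝ × ℝ → ℝ := fun p => weight (1 - α) p.1 * Real.exp (-(p.1 * (t - p.2))) * V p.2
  have hΦm : AEStronglyMeasurable Φ (μ.prod ν) := by
    have := (measurable_weight (1 - α))
    have := hV.measurable
    exact Measurable.aestronglyMeasurable (by fun_prop)
  have hne : ∀ᵐ τ ∂ν, τ ∈ Ioo 0 t := by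
    rw [hν, ← restrict_Ioo_eq_restrict_Ioc]; exact ae_restrict_mem measurableSet_Ioo
  have hk : ∀ v : ℝ → ℝ, (fun τ => ∫ ω, weight (1 - α) ω * Real.exp (-(ω * (t - τ))) * v τ ∂μ)
      =ᵐ[ν] fun τ => 1 / Real.Gamma (1 - α) * ((t - τ) ^ (1 - α - 1) * v τ) := by
    intro v
    filter_upwards [hne] with τ hτ
    rw [integral_mul_const, (integral_weight_mul_exp hα₀ hα₁ (sub_pos.2 hτ.2)).2,
      show 1 - α - 1 = -α by ring]
    ring
  have hi : ∀ v : ℝ → ℝ, Continuous v → Integrable (fun τ => 1 / Real.Gamma (1 - α) *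
      ((t - τ) ^ (1 - α - 1) * v τ)) ν := by
    intro v hv
    rw [hν, ← IntegrableOn, ← intervalIntegrable_iff_integrableOn_Ioc_of_le ht]
    exact ((intervalIntegrable_sub_rpow (by linarith) t).mul_continuousOn
      hv.continuousOn).const_mul _
  -- Integrating the absolute value over ω first leaves the kernel (t - τ)^(-α) times |V|, whose
  -- singularity at τ = t is integrable.
  have hΦ : Integrable Φ (μ.prod ν) := by
    rw [integrable_prod_iff' hΦm]
    constructor
    · filter_upwards [hne] with τ hτ
      exact Integrable.mul_const (integral_weight_mul_exp hα₀ hα₁ (sub_pos.2 hτ.2)).1 (V τ)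
    · refine (hi _ hV.abs).congr (EventuallyEq.trans (hk _).symm (ae_of_all _ fun τ => ?_))
      refine integral_congr_ae ?_
      filter_upwards [ae_restrict_mem measurableSet_Ioi] with ω hω
      simp only [Φ]
      rw [Real.norm_eq_abs, abs_mul, abs_mul, abs_of_pos (weight_pos hα₀ hα₁ hω),
        abs_of_pos (Real.exp_pos _)]
  have hsw : ∫ ω, ∫ τ, Φ (ω, τ) ∂ν ∂μ = ∫ τ, ∫ ω, Φ (ω, τ) ∂μ ∂ν :=
    integral_integral_swap (f := fun ω τ => Φ (ω, τ)) hΦ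
  have hl : ∀ ω, ∫ τ, Φ (ω, τ) ∂ν = weight (1 - α) ω * infState V ω t := by
    intro ω
    rw [infState, intervalIntegral.integral_of_le ht, ← integral_const_mul]
    simp only [Φ, mul_assoc, hν]
  simp only [hl] at hsw
  rw [hsw, integral_congr_ae (hk V), integral_const_mul, rlIntegral,
    intervalIntegral.integral_of_le ht]

end Weight

/-! ### The diffusive energy -/

section Diffusive

variable {α : ℝ} {V : ℝ → ℝ}

theorem exists_abs_le_of_continuous (hV : Continuous V) (T : ℝ) :
    ∃ M : ℝ, 0 ≤ M ∧ ∀ τ ∈ Icc 0 T, |V τ| ≤ M := by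
  obtain ⟨M, hM⟩ := isCompact_Icc.exists_bound_of_continuousOn (s := Icc 0 T) hV.continuousOn
  exact ⟨max M 0, le_max_right _ _, fun τ hτ => (hM τ hτ).trans (le_max_left _ _)⟩

theorem exists_abs_infState_le (hV : Continuous V) (T : ℝ) :
    ∃ B : ℝ, 0 ≤ B ∧ ∀ ω : ℝ, 0 < ω → ∀ t ∈ Icc 0 T, |infState V ω t| ≤ B * min 1 (1 / ω) := by
  obtain ⟨M, hM0, hM⟩ := exists_abs_le_of_continuous hV T
  refine ⟨(|T| + 1) * M, by positivity, fun ω hω t ht => ?_⟩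
  have h := abs_infState_le_min hω ht.1 ht.2 hM
  rwa [abs_of_nonneg (ht.1.trans ht.2)]

theorem continuous_infState_left (hV : Continuous V) (t : ℝ) :
    Continuous fun ω => infState V ω t :=
  (continuous_infState hV).comp (by fun_prop : Continuous fun ω : ℝ => (ω, t))

theorem integrableOn_infState (hα₀ : 0 < α) (hα₁ : α < 1) (hV : Continuous V) {t : ℝ}
    (ht : 0 ≤ t) :
    IntegrableOn (fun ω => weight (1 - α) ω * infState V ω t) (Ioi 0) ∧
    IntegrableOn (fun ω => weight (1 - α) ω * infState V ω t ^ 2) (Ioi 0) ∧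
    IntegrableOn (fun ω => ω * weight (1 - α) ω * infState V ω t ^ 2) (Ioi 0) := by
  obtain ⟨B, hB0, hB⟩ := exists_abs_infState_le hV t
  have hc := continuous_infState_left hV t
  refine ⟨?_, ?_, ?_⟩
  · exact integrableOn_weight_mul hα₀ hα₁ hc.aestronglyMeasurable fun ω hω => hB ω hω t ⟨ht, le_rfl⟩
  · exact integrableOn_weight_mul hα₀ hα₁ (hc.pow 2).aestronglyMeasurable
      fun ω hω => (abs_sq_le_min hω (hB ω hω t ⟨ht, le_rfl⟩)).1
  · refine (integrableOn_weight_mul hα₀ hα₁ (y := fun ω => ω * infState V ω t ^ 2)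
      (Continuous.aestronglyMeasurable (by fun_prop))
      fun ω hω => (abs_sq_le_min hω (hB ω hω t ⟨ht, le_rfl⟩)).2).congr (ae_of_all _ fun ω => ?_)
    ring

/-- Covers t = 0, which the two-sided derivative below does not, so that energy comparisons can
start at the initial data. -/
theorem continuousOn_integral_weight_sq (hα₀ : 0 < α) (hα₁ : α < 1) (hV : Continuous V) :
    ContinuousOn (fun t => ∫ ω in Ioi (0 : ℝ), weight (1 - α) ω * infState V ω t ^ 2)
      (Ici 0) := by
  intro t ht
  obtain ⟨B, hB0, hB⟩ := exists_abs_infState_le hV (t + 1)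
  have hev : ∀ᶠ s in 𝓝[Ici 0] t, s ∈ Icc 0 (t + 1) := by
    filter_upwards [self_mem_nhdsWithin, mem_nhdsWithin_of_mem_nhds (Iio_mem_nhds
      (show t < t + 1 by linarith))] with s h1 h2 using ⟨h1, le_of_lt h2⟩
  refine continuousWithinAt_of_dominated
    (bound := fun ω => B ^ 2 * (weight (1 - α) ω * min 1 (1 / ω))) ?_ ?_
    ((integrableOn_weight_mul_min hα₀ hα₁).const_mul _) ?_
  · exact Eventually.of_forall fun s => (measurable_weight _).aestronglyMeasurable.mul
      ((continuous_infState_left hV s).pow 2).aestronglyMeasurable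
  · filter_upwards [hev] with s hs
    filter_upwards [ae_restrict_mem measurableSet_Ioi] with ω hω
    exact abs_weight_mul_le hα₀ hα₁ hω (abs_sq_le_min hω (hB ω hω s hs)).1
  · refine ae_of_all _ fun ω => ?_
    exact (((hasDerivAt_infState hV ω t).continuousAt.pow 2).const_mul _).continuousWithinAt

theorem hasDerivAt_integral_weight_sq (hα₀ : 0 < α) (hα₁ : α < 1) (hV : Continuous V) {t : ℝ}
    (ht : 0 < t) :
    HasDerivAt (fun t => ∫ ω in Ioi (0 : ℝ), weight (1 - α) ω * infState V ω t ^ 2)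
      (2 * V t * (∫ ω in Ioi (0 : ℝ), weight (1 - α) ω * infState V ω t) -
        2 * dissipation α (infState V) t) t := by
  obtain ⟨B, hB0, hB⟩ := exists_abs_infState_le hV (t + 1)
  obtain ⟨M, hM0, hM⟩ := exists_abs_le_of_continuous hV (t + 1)
  have hs : Ioo 0 (t + 1) ∈ 𝓝 t := Ioo_mem_nhds ht (by linarith)
  obtain ⟨i1, i2, i3⟩ := integrableOn_infState hα₀ hα₁ hV ht.le
  have key := (hasDerivAt_integral_of_dominated_loc_of_deriv_le (μ := volume.restrict (Ioi 0))
    (F := fun t ω => weight (1 - α) ω * infState V ω t ^ 2)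
    (F' := fun t ω => weight (1 - α) ω *
      (2 * infState V ω t * (-ω * infState V ω t + V t)))
    -- One factor z supplies B min(1, 1/ω); the other factor -ωz + V is at most B + M because ω
    -- min(1, 1/ω) ≤ 1.
    (bound := fun ω => 2 * B * (B + M) * (weight (1 - α) ω * min 1 (1 / ω))) hs
    (Eventually.of_forall fun s => (measurable_weight _).aestronglyMeasurable.mul
      ((continuous_infState_left hV s).pow 2).aestronglyMeasurable) i2
    ((measurable_weight _).aestronglyMeasurable.mul (Continuous.aestronglyMeasurable (by
      have := continuous_infState_left hV t
      fun_prop))) ?_ ((integrableOn_weight_mul_min hα₀ hα₁).const_mul _) ?_).2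
  · refine key.congr_deriv ?_
    rw [dissipation, ← integral_const_mul, ← integral_const_mul, ← integral_sub
      (i1.const_mul _) (i3.const_mul _)]
    congr 1
    funext ω
    ring
  · filter_upwards [ae_restrict_mem measurableSet_Ioi] with ω hω s hs
    have hω' : 0 < ω := hω
    refine abs_weight_mul_le hα₀ hα₁ hω ?_
    obtain ⟨h0, h1, h2⟩ := min_one_one_div_bounds hω
    have hb := hB ω hω s ⟨hs.1.le, hs.2.le⟩
    have h3 : |-ω * infState V ω s + V s| ≤ B + M := by
      refine (abs_add_le _ _).trans (add_le_add ?_ (hM s ⟨hs.1.le, hs.2.le⟩))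
      rw [abs_mul, abs_neg, abs_of_pos hω']
      nlinarith
    rw [abs_mul, abs_mul, abs_two]
    calc 2 * |infState V ω s| * |-ω * infState V ω s + V s|
        ≤ 2 * (B * min 1 (1 / ω)) * (B + M) := by gcongr
      _ = _ := by ring
  · refine ae_of_all _ fun ω s _ => ?_
    refine (((hasDerivAt_infState hV ω s).pow 2).const_mul (weight (1 - α) ω)).congr_deriv ?_
    simp

theorem dissipation_nonneg (hα₀ : 0 < α) (hα₁ : α < 1) (z : ℝ → ℝ → ℝ) (t : ℝ) :
    0 ≤ dissipation α z t := by
  refine setIntegral_nonneg measurableSet_Ioi fun ω hω => ?_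
  have := weight_pos hα₀ hα₁ hω
  have : 0 < ω := hω
  positivity

/-- A continuous function on `[0, t]` whose finite Laplace transform vanishes at the positive
integers is zero. -/
theorem eq_zero_of_infState_nat_eq_zero (hV : Continuous V) {t : ℝ} (ht : 0 < t)
    (h : ∀ n : ℕ, infState V (n + 1) t = 0) : ∀ τ ∈ Icc 0 t, V τ = 0 := by
  -- In the variable u = exp(-(t - τ)) the vanishing transforms say that H is orthogonal to all
  -- powers of u.
  let u : ℝ → ℝ := fun τ => Real.exp (-(t - τ))
  let H : ℝ → ℝ := fun τ => u τ * V τ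
  have hu : Continuous u := by fun_prop
  have hH : Continuous H := hu.mul hV
  have hpow : ∀ n : ℕ, ∫ τ in (0 : ℝ)..t, u τ ^ n * H τ = 0 := by
    intro n
    refine Eq.trans ?_ (h n)
    rw [infState]
    refine intervalIntegral.integral_congr fun τ _ => ?_
    simp only [u, H, ← mul_assoc, ← Real.exp_nat_mul, ← Real.exp_add]
    ring_nf
  have hpoly : ∀ p : Polynomial ℝ, ∫ τ in (0 : ℝ)..t, p.eval (u τ) * H τ = 0 := by
    intro p
    have : ∀ τ, p.eval (u τ) * H τ = ∑ i ∈ Finset.range (p.natDegree + 1),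
        p.coeff i * (u τ ^ i * H τ) := by
      intro τ
      rw [Polynomial.eval_eq_sum_range, Finset.sum_mul]
      exact Finset.sum_congr rfl fun i _ => by ring
    simp only [this]
    rw [intervalIntegral.integral_finsetSum
      (fun i _ => Continuous.intervalIntegrable (by fun_prop) _ _)]
    refine Finset.sum_eq_zero fun i _ => ?_
    rw [intervalIntegral.integral_const_mul, hpow, mul_zero]
  have hle : ∀ ε > 0, ∫ τ in (0 : ℝ)..t, H τ ^ 2 ≤ ε * ∫ τ in (0 : ℝ)..t, |H τ| := by
    intro ε hε
    -- H is a continuous function of u on [exp(-t), 1]. Subtracting a polynomial approximation from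
    -- one factor of H² does not change the integral, by orthogonality.
    obtain ⟨p, hp⟩ := exists_polynomial_near_of_continuousOn (Real.exp (-t)) 1
      (fun w => w * V (t + Real.log w)) (by
        refine continuousOn_id.mul (hV.comp_continuousOn ?_)
        refine continuousOn_const.add (Real.continuousOn_log.mono fun w hw => ?_)
        exact ((Real.exp_pos _).trans_le hw.1).ne') ε hε
    have hpc : Continuous fun τ => p.eval (u τ) := p.continuous.comp hu
    have e : ∫ τ in (0 : ℝ)..t, H τ ^ 2 = ∫ τ in (0 : ℝ)..t, (H τ - p.eval (u τ)) * H τ := by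
      have : ∀ τ, (H τ - p.eval (u τ)) * H τ = H τ ^ 2 - p.eval (u τ) * H τ := fun τ => by ring
      simp only [this]
      rw [intervalIntegral.integral_sub (Continuous.intervalIntegrable (by fun_prop) _ _)
        (Continuous.intervalIntegrable (by fun_prop) _ _), hpoly, sub_zero]
    rw [e, ← intervalIntegral.integral_const_mul]
    refine intervalIntegral.integral_mono_on ht.le (Continuous.intervalIntegrable (by fun_prop) _ _)
      (Continuous.intervalIntegrable (by fun_prop) _ _) fun τ hτ => ?_
    refine (le_abs_self _).trans ?_
    rw [abs_mul]
    gcongr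
    have h1 := hp (u τ) ⟨Real.exp_le_exp.2 (by linarith [hτ.1]),
      Real.exp_le_one_iff.2 (by linarith [hτ.2])⟩
    have h2 : t + Real.log (u τ) = τ := by simp only [u, Real.log_exp]; ring
    rw [h2] at h1
    rw [abs_sub_comm]
    exact h1.le
  have hzero : ∫ τ in (0 : ℝ)..t, H τ ^ 2 = 0 := by
    refine le_antisymm (le_of_forall_pos_lt_add fun δ hδ => ?_)
      (intervalIntegral.integral_nonneg ht.le fun τ _ => sq_nonneg _)
    have hI : 0 ≤ ∫ τ in (0 : ℝ)..t, |H τ| :=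
      intervalIntegral.integral_nonneg ht.le fun τ _ => abs_nonneg _
    refine (hle (δ / ((∫ τ in (0 : ℝ)..t, |H τ|) + 1)) (by positivity)).trans_lt ?_
    rw [zero_add, div_mul_eq_mul_div, div_lt_iff₀ (by positivity)]
    nlinarith
  rw [intervalIntegral.integral_of_le ht.le, ← integral_Icc_eq_integral_Ioc,
    setIntegral_eq_zero_iff_of_nonneg_ae (ae_of_all _ fun τ => sq_nonneg _)
      (Continuous.integrableOn_Icc (by fun_prop))] at hzero
  have hE := Measure.eqOn_Icc_of_ae_eq volume ht.ne hzero (by fun_prop) continuousOn_const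
  intro τ hτ
  have h1 := hE hτ
  simp only [Pi.zero_apply, ne_eq, OfNat.ofNat_ne_zero, not_false_eq_true, pow_eq_zero_iff, H,
    mul_eq_zero] at h1
  exact h1.resolve_left (Real.exp_ne_zero _)

/-- The integrand is nonnegative, so z(·, t) vanishes for almost every frequency, hence for every ω
> 0 by continuity, in particular at the positive integers. -/
theorem eq_zero_of_dissipation_eq_zero (hα₀ : 0 < α) (hα₁ : α < 1) (hV : Continuous V) {t : ℝ}
    (ht : 0 < t) (h : dissipation α (infState V) t = 0) : ∀ τ ∈ Icc 0 t, V τ = 0 := by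
  have i3 := (integrableOn_infState hα₀ hα₁ hV ht.le).2.2
  have hc := continuous_infState_left hV t
  rw [dissipation, setIntegral_eq_zero_iff_of_nonneg_ae _ i3] at h
  · have h2 : (fun ω => infState V ω t) =ᵐ[volume.restrict (Ioi 0)] fun _ => 0 := by
      filter_upwards [h, ae_restrict_mem measurableSet_Ioi] with ω h1 hω
      have := (weight_pos hα₀ hα₁ hω).ne'
      have : ω ≠ 0 := (mem_Ioi.1 hω).ne'
      simp_all
    have h3 := Measure.eqOn_open_of_ae_eq h2 isOpen_Ioi hc.continuousOn continuousOn_const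
    exact eq_zero_of_infState_nat_eq_zero hV ht fun n => h3 (mem_Ioi.2 (by positivity))
  · filter_upwards [ae_restrict_mem measurableSet_Ioi] with ω hω
    have := weight_pos hα₀ hα₁ hω
    have : 0 < ω := hω
    simp only [Pi.zero_apply]
    positivity

end Diffusive

/-! ### Energy balance of a motion -/

/-- The velocity on `[0, ∞)`, extended by its value at `0` to the left. -/
noncomputable def extVelocity (x : ℝ → ℝ) (t : ℝ) : ℝ := velocity x (max t 0)

theorem extVelocity_of_nonneg (x : ℝ → ℝ) {t : ℝ} (ht : 0 ≤ t) :
    extVelocity x t = velocity x t := by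
  rw [extVelocity, max_eq_left ht]

namespace HasAcceleration

variable {x g : ℝ → ℝ} {α c k : ℝ}

theorem continuous_extVelocity (h : HasAcceleration x g) : Continuous (extVelocity x) :=
  h.continuousOn_velocity.comp_continuous (by fun_prop) fun _ => mem_Ici.2 (le_max_right _ _)

theorem isInfiniteState (h : HasAcceleration x g) :
    IsInfiniteState x (infState (extVelocity x)) := by
  intro ω _
  refine ⟨infState_zero _ _, fun t ht => ?_⟩
  have := (hasDerivAt_infState h.continuous_extVelocity ω t).hasDerivWithinAt (s := Ici 0)
  rwa [extVelocity_of_nonneg x ht] at this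

theorem eq_infState (h : HasAcceleration x g) {z : ℝ → ℝ → ℝ} (hz : IsInfiniteState x z)
    {ω : ℝ} (hω : 0 < ω) {t : ℝ} (ht : 0 ≤ t) : z ω t = infState (extVelocity x) ω t := by
  obtain ⟨h0, h1⟩ := hz ω hω
  have := eq_infState_of_hasDerivWithinAt (z := z ω) (ω := ω) h.continuous_extVelocity
    (fun s hs => by rw [extVelocity_of_nonneg x hs]; exact h1 s hs) ht
  rw [this, h0]
  simp

theorem caputo_eq_integral_weight (h : HasAcceleration x g) (hα₀ : 0 < α) (hα₁ : α < 1) {t : ℝ}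
    (ht : 0 ≤ t) :
    caputo α x t = ∫ ω in Ioi (0 : ℝ), weight (1 - α) ω * infState (extVelocity x) ω t := by
  rw [integral_weight_mul_infState hα₀ hα₁ h.continuous_extVelocity ht,
    h.caputo_eq_rlIntegral α ht]
  exact rlIntegral_congr ht (ae_of_all _ fun τ hτ => (extVelocity_of_nonneg x hτ.1.le).symm)

theorem abs_infState_le (h : HasAcceleration x g) {ω t X M : ℝ} (hω : 0 < ω)
    (ht : 0 ≤ t) (hX : ∀ τ ∈ Icc 0 t, |x τ| ≤ X) (hM : ∀ τ ∈ Icc 0 t, |velocity x τ| ≤ M) :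
    |infState (extVelocity x) ω t| ≤ (3 * X + M) * min 1 (1 / ω) := by
  refine abs_infState_le_position h.continuous_extVelocity hω ht h.continuousOn (fun s hs => ?_) hX
    fun τ hτ => ?_
  · rw [extVelocity_of_nonneg x hs]; exact h.hasDerivWithinAt hs
  · rw [extVelocity_of_nonneg x hτ.1]; exact hM τ hτ

theorem abs_caputo_le (h : HasAcceleration x g) (hα₀ : 0 < α) (hα₁ : α < 1) {t X M : ℝ}
    (ht : 0 ≤ t) (hX : ∀ τ ∈ Icc 0 t, |x τ| ≤ X) (hM : ∀ τ ∈ Icc 0 t, |velocity x τ| ≤ M) :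
    |caputo α x t| ≤
      (3 * X + M) * ∫ ω in Ioi (0 : ℝ), weight (1 - α) ω * min 1 (1 / ω) := by
  rw [h.caputo_eq_integral_weight hα₀ hα₁ ht, ← integral_const_mul, ← Real.norm_eq_abs]
  refine norm_integral_le_of_norm_le ((integrableOn_weight_mul_min hα₀ hα₁).const_mul _) ?_
  filter_upwards [ae_restrict_mem measurableSet_Ioi] with ω hω
  exact abs_weight_mul_le hα₀ hα₁ hω (h.abs_infState_le hω ht hX hM)

/-- If the acceleration agrees almost everywhere with a continuous function from some time on, then
the velocity is differentiable at every later time. -/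
theorem hasDerivAt_velocity (h : HasAcceleration x g) {T : ℝ} (hT : 0 ≤ T) {φ : ℝ → ℝ}
    (hφ : ContinuousOn φ (Ici 0))
    (hg : ∀ᵐ t ∂(volume.restrict (Ici (0 : ℝ))), T < t → deriv (velocity x) t = φ t)
    {t : ℝ} (ht : T < t) : HasDerivAt (velocity x) (φ t) t := by
  have hc : Continuous fun s => φ (max s 0) :=
    hφ.comp_continuous (by fun_prop) fun _ => mem_Ici.2 (le_max_right _ _)
  have h1 : HasDerivAt (fun s => velocity x T + ∫ τ in T..s, φ (max τ 0)) (φ (max t 0)) t :=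
    (hc.integral_hasStrictDerivAt T t).hasDerivAt.const_add _
  rw [max_eq_left (hT.trans ht.le)] at h1
  refine h1.congr_of_eventuallyEq ?_
  filter_upwards [Ioi_mem_nhds ht] with s hs
  have hs' : T < s := hs
  have h2 : ∫ τ in T..s, deriv (velocity x) τ = velocity x s - velocity x T :=
    ((h.velocity_ac s (hT.trans hs'.le)).mono (by
      rw [uIcc_of_le hs'.le, uIcc_of_le (hT.trans hs'.le)]
      exact Icc_subset_Icc_left hT)).integral_deriv_eq_sub
  have h3 : ∫ τ in T..s, deriv (velocity x) τ = ∫ τ in T..s, φ (max τ 0) := by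
    refine intervalIntegral.integral_congr_ae ?_
    rw [ae_restrict_iff' measurableSet_Ici] at hg
    filter_upwards [hg] with τ hτ hm
    rw [uIoc_of_le hs'.le] at hm
    rw [max_eq_left (hT.trans hm.1.le), hτ (hT.trans hm.1.le) hm.1]
  rw [← h3, h2]
  ring

/-- The elastic terms k x x' cancel, and the term -c x' x₂ from the acceleration cancels c x' ∫ μ z
from the diffusive part. The equation is required at the time t alone, so the balance also applies
after a reaching time. -/
theorem hasDerivAt_energy (h : HasAcceleration x g) (hα₀ : 0 < α) (hα₁ : α < 1) {t : ℝ}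
    (ht : 0 < t) (hv : HasDerivAt (velocity x) (-k * x t - c * caputo α x t) t) :
    HasDerivAt (energy α c k x (infState (extVelocity x)))
      (-c * dissipation α (infState (extVelocity x)) t) t := by
  have h1 := hasDerivAt_integral_weight_sq hα₀ hα₁ h.continuous_extVelocity ht
  rw [← h.caputo_eq_integral_weight hα₀ hα₁ ht.le, extVelocity_of_nonneg x ht.le] at h1
  refine (((((h.hasDerivAt ht).pow 2).const_mul (1 / 2 * k)).add
    ((hv.pow 2).const_mul (1 / 2))).add (h1.const_mul (c / 2))).congr_deriv ?_
  simp only [Nat.cast_ofNat, Nat.add_one_sub_one, pow_one]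
  ring

theorem continuousOn_energy (h : HasAcceleration x g) (hα₀ : 0 < α) (hα₁ : α < 1) :
    ContinuousOn (energy α c k x (infState (extVelocity x))) (Ici 0) :=
  (((h.continuousOn.pow 2).const_mul (1 / 2 * k)).add
    ((h.continuousOn_velocity.pow 2).const_mul (1 / 2))).add
    ((continuousOn_integral_weight_sq hα₀ hα₁ h.continuous_extVelocity).const_mul (c / 2))

theorem antitoneOn_energy (h : HasAcceleration x g) (hα₀ : 0 < α) (hα₁ : α < 1) (hc : 0 < c)
    {T : ℝ} (hT : 0 ≤ T)
    (hv : ∀ t, T < t → HasDerivAt (velocity x) (-k * x t - c * caputo α x t) t) :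
    AntitoneOn (energy α c k x (infState (extVelocity x))) (Ici T) := by
  have hd : ∀ t, T < t → HasDerivAt (energy α c k x (infState (extVelocity x)))
      (-c * dissipation α (infState (extVelocity x)) t) t :=
    fun t ht => h.hasDerivAt_energy hα₀ hα₁ (hT.trans_lt ht) (hv t ht)
  refine antitoneOn_of_deriv_nonpos (convex_Ici T)
    ((h.continuousOn_energy hα₀ hα₁).mono (Ici_subset_Ici.2 hT)) ?_ ?_
  · rw [interior_Ici]
    exact fun t ht => (hd t ht).differentiableAt.differentiableWithinAt
  · rw [interior_Ici]
    intro t ht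
    rw [(hd t ht).deriv]
    nlinarith [dissipation_nonneg hα₀ hα₁ (infState (extVelocity x)) t]

end HasAcceleration

theorem energy_ge {α c : ℝ} (hα₀ : 0 < α) (hα₁ : α < 1) (hc : 0 < c) (k : ℝ) (x : ℝ → ℝ)
    (z : ℝ → ℝ → ℝ) (t : ℝ) :
    1 / 2 * k * x t ^ 2 + 1 / 2 * velocity x t ^ 2 ≤ energy α c k x z t := by
  unfold energy
  have : 0 ≤ ∫ ω in Ioi (0 : ℝ), weight (1 - α) ω * z ω t ^ 2 :=
    setIntegral_nonneg measurableSet_Ioi fun ω hω => by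
      have := weight_pos hα₀ hα₁ hω
      positivity
  have : 0 ≤ c / 2 * ∫ ω in Ioi (0 : ℝ), weight (1 - α) ω * z ω t ^ 2 := by positivity
  linarith

theorem energy_infState_zero (α c k : ℝ) (x V : ℝ → ℝ) :
    energy α c k x (infState V) 0 = 1 / 2 * k * x 0 ^ 2 + 1 / 2 * velocity x 0 ^ 2 := by
  simp [energy, infState_zero]

/-! ### Sliding motions -/

namespace IsSlidingMotion

variable {x : ℝ → ℝ} {α c k : ℝ}

theorem continuousOn_acceleration {g : ℝ → ℝ} (h : HasAcceleration x g) (hα₁ : α < 1) :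
    ContinuousOn (fun t => -k * x t - c * caputo α x t) (Ici 0) :=
  (h.continuousOn.const_mul _).sub ((h.continuousOn_caputo hα₁).const_mul _)

theorem hasDerivAt_velocity (h : IsSlidingMotion α c k x) (hα₁ : α < 1) {t : ℝ} (ht : 0 < t) :
    HasDerivAt (velocity x) (-k * x t - c * caputo α x t) t :=
  HasAcceleration.hasDerivAt_velocity h le_rfl (continuousOn_acceleration h hα₁)
    (by filter_upwards [HasAcceleration.deriv_velocity h] with s hs _ using hs) ht

/-- Zero velocity on [0, t] makes the memory term and the acceleration vanish at the interior point
t/2. The equation there leaves k x = 0, and x is constant up to t/2. -/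
theorem initial_eq_zero_of_dissipation_eq_zero (h : IsSlidingMotion α c k x) (hα₀ : 0 < α)
    (hα₁ : α < 1) (hk : 0 < k) {t : ℝ} (ht : 0 < t)
    (hD : dissipation α (infState (extVelocity x)) t = 0) : x 0 = 0 ∧ velocity x 0 = 0 := by
  have ha : HasAcceleration x _ := h
  have hV := eq_zero_of_dissipation_eq_zero hα₀ hα₁ ha.continuous_extVelocity ht hD
  have hv : ∀ s ∈ Icc 0 t, velocity x s = 0 := fun s hs => by
    rw [← extVelocity_of_nonneg x hs.1]; exact hV s hs
  refine ⟨?_, hv 0 ⟨le_rfl, ht.le⟩⟩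
  have hs : t / 2 ∈ Ioo 0 t := ⟨by linarith, by linarith⟩
  have hy : caputo α x (t / 2) = 0 := by
    rw [ha.caputo_eq_rlIntegral α hs.1.le, rlIntegral_congr (g := fun _ => 0) hs.1.le
      (ae_of_all _ fun τ hτ => hv τ ⟨hτ.1.le, hτ.2.trans hs.2.le⟩)]
    simp [rlIntegral]
  have hd := h.hasDerivAt_velocity hα₁ hs.1
  have hd0 : HasDerivAt (velocity x) 0 (t / 2) := by
    refine (hasDerivAt_const (t / 2) (0 : ℝ)).congr_of_eventuallyEq ?_
    filter_upwards [Ioo_mem_nhds hs.1 hs.2] with s hs using hv s ⟨hs.1.le, hs.2.le⟩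
  have hx : x (t / 2) = 0 := by
    have := hd.unique hd0
    rw [hy] at this
    simpa [hk.ne'] using this
  refine Eq.trans ?_ hx
  refine (constant_of_has_deriv_right_zero (ha.continuousOn.mono fun s hs => hs.1) (fun s hs => ?_)
    (t / 2) ⟨hs.1.le, le_rfl⟩).symm
  have := (ha.hasDerivWithinAt hs.1).mono (Ici_subset_Ici.2 hs.1)
  rwa [hv s ⟨hs.1, by linarith [hs.2]⟩] at this

/-- The infinite state is unique for ω > 0, so every claim transfers from `infState`. -/
theorem energy_balance (h : IsSlidingMotion α c k x) (hα₀ : 0 < α) (hα₁ : α < 1) (hc : 0 < c)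
    (hk : 0 < k) {z : ℝ → ℝ → ℝ} (hz : IsInfiniteState x z) :
    (∀ t : ℝ, 0 ≤ t → IntegrableOn (fun ω => weight (1 - α) ω * z ω t) (Ioi 0) ∧
      caputo α x t = ∫ ω in Ioi (0 : ℝ), weight (1 - α) ω * z ω t) ∧
    (∀ t : ℝ, 0 ≤ t → IntegrableOn (fun ω => weight (1 - α) ω * z ω t ^ 2) (Ioi 0) ∧
      IntegrableOn (fun ω => ω * weight (1 - α) ω * z ω t ^ 2) (Ioi 0)) ∧
    (∀ t : ℝ, 0 < t → HasDerivAt (energy α c k x z) (-c * dissipation α z t) t) ∧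
    (x 0 ≠ 0 ∨ velocity x 0 ≠ 0 → ∀ t : ℝ, 0 < t → -c * dissipation α z t < 0) := by
  have ha : HasAcceleration x _ := h
  have e : ∀ t : ℝ, 0 ≤ t → ∀ ω ∈ Ioi (0 : ℝ), infState (extVelocity x) ω t = z ω t :=
    fun t ht ω hω => (ha.eq_infState hz hω ht).symm
  have eD : ∀ t : ℝ, 0 ≤ t → dissipation α (infState (extVelocity x)) t = dissipation α z t :=
    fun t ht => setIntegral_congr_fun measurableSet_Ioi fun ω hω => by simp only [e t ht ω hω]
  have eE : ∀ t : ℝ, 0 ≤ t → energy α c k x z t =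
      energy α c k x (infState (extVelocity x)) t := fun t ht => by
    unfold energy
    congr 2
    exact setIntegral_congr_fun measurableSet_Ioi fun ω hω => by simp only [e t ht ω hω]
  refine ⟨fun t ht => ⟨?_, ?_⟩, fun t ht => ⟨?_, ?_⟩, fun t ht => ?_, fun h0 t ht => ?_⟩
  · exact (integrableOn_infState hα₀ hα₁ ha.continuous_extVelocity ht).1.congr_fun
      (fun ω hω => by simp only [e t ht ω hω]) measurableSet_Ioi
  · rw [ha.caputo_eq_integral_weight hα₀ hα₁ ht]
    exact setIntegral_congr_fun measurableSet_Ioi fun ω hω => by simp only [e t ht ω hω]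
  · exact (integrableOn_infState hα₀ hα₁ ha.continuous_extVelocity ht).2.1.congr_fun
      (fun ω hω => by simp only [e t ht ω hω]) measurableSet_Ioi
  · exact (integrableOn_infState hα₀ hα₁ ha.continuous_extVelocity ht).2.2.congr_fun
      (fun ω hω => by simp only [e t ht ω hω]) measurableSet_Ioi
  · rw [← eD t ht.le]
    refine (ha.hasDerivAt_energy hα₀ hα₁ ht (h.hasDerivAt_velocity hα₁ ht)).congr_of_eventuallyEq ?_
    filter_upwards [Ioi_mem_nhds ht] with s hs using eE s (le_of_lt hs)
  · have h1 := dissipation_nonneg hα₀ hα₁ z t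
    have h2 : dissipation α z t ≠ 0 := fun h2 => by
      rw [← eD t ht.le] at h2
      obtain ⟨h3, h4⟩ := h.initial_eq_zero_of_dissipation_eq_zero hα₀ hα₁ hk ht h2
      tauto
    have : 0 < dissipation α z t := lt_of_le_of_ne h1 h2.symm
    nlinarith

theorem sq_bounds (h : IsSlidingMotion α c k x) (hα₀ : 0 < α) (hα₁ : α < 1) (hc : 0 < c)
    {t : ℝ} (ht : 0 ≤ t) :
    k * x t ^ 2 + velocity x t ^ 2 ≤ k * x 0 ^ 2 + velocity x 0 ^ 2 := by
  have h1 := HasAcceleration.antitoneOn_energy (k := k) h hα₀ hα₁ hc le_rfl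
    (fun t ht => h.hasDerivAt_velocity hα₁ ht) (mem_Ici.2 le_rfl) (mem_Ici.2 ht) ht
  rw [energy_infState_zero] at h1
  have h2 := energy_ge hα₀ hα₁ hc k x (infState (extVelocity x)) t
  linarith

end IsSlidingMotion

/-- Lyapunov stability of the sliding dynamics. -/
theorem sliding_stable {α c k : ℝ} (hα₀ : 0 < α) (hα₁ : α < 1) (hc : 0 < c) (hk : 0 < k)
    {ε : ℝ} (hε : 0 < ε) : ∃ δ : ℝ, 0 < δ ∧
      ∀ x : ℝ → ℝ, IsSlidingMotion α c k x → |x 0| < δ → |velocity x 0| < δ →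
        ∀ t : ℝ, 0 ≤ t → |x t| < ε ∧ |caputo α x t| < ε ∧ |velocity x t| < ε := by
  set K := ∫ ω in Ioi (0 : ℝ), weight (1 - α) ω * min 1 (1 / ω) with hK
  have hK0 : 0 ≤ K := setIntegral_nonneg measurableSet_Ioi fun ω hω =>
    mul_nonneg (weight_pos hα₀ hα₁ hω).le (min_one_one_div_bounds hω).1
  -- The energy gives k x² + x'² ≤ (k + 1) δ²; the two summands bound |x|/δ and |x'|/δ respectively.
  set A := √((k + 1) / k) + √(k + 1) with hA
  have hA0 : 0 < A := by positivity
  have hden : 0 < A * (4 * K + 1) + 1 := by positivity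
  -- With X = M = Aδ, the bound (3X + M) K on x₂ is 4KAδ; the extra summands leave room for x and x'
  -- and make the inequalities strict.
  refine ⟨ε / (A * (4 * K + 1) + 1), by positivity, fun x h hx hv => ?_⟩
  set δ := ε / (A * (4 * K + 1) + 1) with hδ
  have hδ0 : 0 < δ := by positivity
  have hδε : A * δ * (4 * K + 1) < ε := by
    have : δ * (A * (4 * K + 1) + 1) = ε := by rw [hδ]; field_simp
    nlinarith
  have hb : ∀ t : ℝ, 0 ≤ t → |x t| ≤ A * δ ∧ |velocity x t| ≤ A * δ := by
    intro t ht
    have h1 := h.sq_bounds hα₀ hα₁ hc ht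
    have hx2 : x 0 ^ 2 ≤ δ ^ 2 := sq_le_sq' (by linarith [(abs_lt.1 hx).1]) (abs_lt.1 hx).2.le
    have hv2 : velocity x 0 ^ 2 ≤ δ ^ 2 :=
      sq_le_sq' (by linarith [(abs_lt.1 hv).1]) (abs_lt.1 hv).2.le
    have h2 : k * x t ^ 2 + velocity x t ^ 2 ≤ (k + 1) * δ ^ 2 := by nlinarith
    have h3 : x t ^ 2 ≤ (√((k + 1) / k) * δ) ^ 2 := by
      rw [mul_pow, Real.sq_sqrt (by positivity), div_mul_eq_mul_div, le_div_iff₀ hk]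
      nlinarith [sq_nonneg (velocity x t)]
    have h4 : velocity x t ^ 2 ≤ (√(k + 1) * δ) ^ 2 := by
      rw [mul_pow, Real.sq_sqrt (by positivity)]
      nlinarith [mul_nonneg hk.le (sq_nonneg (x t))]
    have h5 := abs_le_of_sq_le_sq h3 (by positivity)
    have h6 := abs_le_of_sq_le_sq h4 (by positivity)
    have h7 : 0 ≤ √((k + 1) / k) * δ := by positivity
    have h8 : 0 ≤ √(k + 1) * δ := by positivity
    rw [hA, add_mul]
    exact ⟨by linarith, by linarith⟩
  intro t ht
  have hAδ : A * δ < ε := by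
    have : 0 ≤ A * δ * (4 * K) := by positivity
    linarith
  refine ⟨(hb t ht).1.trans_lt hAδ, ?_, (hb t ht).2.trans_lt hAδ⟩
  have hy := HasAcceleration.abs_caputo_le h hα₀ hα₁ ht (fun τ hτ => (hb τ hτ.1).1)
    (fun τ hτ => (hb τ hτ.1).2)
  rw [← hK] at hy
  have : 0 < A * δ := by positivity
  linarith

/-! ### Convergence -/

theorem abs_sub_le_of_hasDerivAt {f f' : ℝ → ℝ} {T K : ℝ}
    (hd : ∀ t, T < t → HasDerivAt f (f' t) t) (hK : ∀ t, T < t → |f' t| ≤ K) {s t : ℝ}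
    (hs : T < s) (hst : s ≤ t) : |f t - f s| ≤ K * (t - s) := by
  have := (convex_Ioi T).norm_image_sub_le_of_norm_hasDerivWithin_le (f := f) (f' := f') (C := K)
    (fun u hu => (hd u hu).hasDerivWithinAt) (fun u hu => hK u hu) (mem_Ioi.2 hs)
    (mem_Ioi.2 (hs.trans_le hst))
  rwa [Real.norm_eq_abs, Real.norm_eq_abs, abs_of_nonneg (sub_nonneg.2 hst)] at this

/-- A form of Barbalat's lemma: if `φ` converges and `φ' = ψ + r` with `ψ` Lipschitz and `r → 0`,
then `ψ → 0`. -/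
theorem tendsto_zero_of_hasDerivAt_add {φ ψ r : ℝ → ℝ} {T K l : ℝ} (hK : 0 ≤ K)
    (hφ : Tendsto φ atTop (𝓝 l)) (hd : ∀ t, T < t → HasDerivAt φ (ψ t + r t) t)
    (hψ : ∀ s t, T < s → s ≤ t → |ψ t - ψ s| ≤ K * (t - s)) (hr : Tendsto r atTop (𝓝 0)) :
    Tendsto ψ atTop (𝓝 0) := by
  rw [Metric.tendsto_atTop]
  intro ε hε
  set h := ε / (4 * (K + 1)) with hh
  have hh0 : 0 < h := by positivity
  have hKh : K * h ≤ ε / 4 := by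
    have : h * (4 * (K + 1)) = ε := by rw [hh]; field_simp
    nlinarith
  have h1 : Tendsto (fun t => φ (t + h) - φ t) atTop (𝓝 0) := by
    have := (hφ.comp (tendsto_atTop_add_const_right atTop h tendsto_id)).sub hφ
    simpa using this
  obtain ⟨N1, hN1⟩ := Metric.tendsto_atTop.1 h1 (ε / 4 * h) (by positivity)
  obtain ⟨N2, hN2⟩ := Metric.tendsto_atTop.1 hr (ε / 4) (by positivity)
  refine ⟨max (max N1 N2) (T + 1), fun t ht => ?_⟩
  have ht1 : N1 ≤ t := (le_max_left _ _).trans ((le_max_left _ _).trans ht)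
  have ht2 : N2 ≤ t := (le_max_right _ _).trans ((le_max_left _ _).trans ht)
  have ht3 : T < t := by linarith [(le_max_right (max N1 N2) (T + 1)).trans ht]
  -- Some ξ in (t, t + h) has φ'(ξ) below ε/4 in absolute value. The remainder r(ξ) and the change
  -- of ψ over [t, ξ] cost at most ε/4 each.
  obtain ⟨ξ, hξ, he⟩ := exists_hasDerivAt_eq_slope φ (fun s => ψ s + r s)
    (show t < t + h by linarith)
    (fun s hs => (hd s (ht3.trans_le hs.1)).continuousAt.continuousWithinAt)
    (fun s hs => hd s (ht3.trans hs.1))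
  have a1 := hN1 t ht1
  have a2 := hN2 ξ (ht2.trans hξ.1.le)
  rw [Real.dist_eq, sub_zero] at a1 a2 ⊢
  have a3 := hψ t ξ ht3 hξ.1.le
  have a4 : K * (ξ - t) ≤ K * h := by
    gcongr
    linarith [hξ.2]
  have a5 : |ψ ξ + r ξ| < ε / 4 := by
    rw [he, add_sub_cancel_left, abs_div, abs_of_pos hh0, div_lt_iff₀ hh0]
    exact a1
  have b3 := abs_le.1 a3
  have b5 := abs_lt.1 a5
  have b2 := abs_lt.1 a2
  rw [abs_lt]
  constructor <;> linarith [b3.1, b3.2, b5.1, b5.2, b2.1, b2.2]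

theorem exists_abs_le_of_continuousOn_of_tail {f : ℝ → ℝ} (hf : ContinuousOn f (Ici 0)) {T C : ℝ}
    (hC : ∀ t, T ≤ t → |f t| ≤ C) : ∃ B : ℝ, 0 ≤ B ∧ ∀ t, 0 ≤ t → |f t| ≤ B := by
  obtain ⟨B, hB⟩ := isCompact_Icc.exists_bound_of_continuousOn (s := Icc 0 T)
    (hf.mono fun s hs => hs.1)
  refine ⟨max (max B C) 0, le_max_right _ _, fun t ht => ?_⟩
  rcases le_total t T with h | h
  · exact (hB t ⟨ht, h⟩).trans ((le_max_left _ _).trans (le_max_left _ _))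
  · exact (hC t h).trans ((le_max_right _ _).trans (le_max_left _ _))

theorem tendsto_of_antitoneOn_of_nonneg {f : ℝ → ℝ} {T : ℝ} (hf : AntitoneOn f (Ici T))
    (h0 : ∀ t, 0 ≤ f t) : ∃ l, Tendsto f atTop (𝓝 l) := by
  have ha : Antitone fun t => f (max t T) := fun s t hst =>
    hf (mem_Ici.2 (le_max_right _ _)) (mem_Ici.2 (le_max_right _ _)) (max_le_max_right T hst)
  refine ⟨_, (tendsto_atTop_ciInf ha ⟨0, ?_⟩).congr' ?_⟩
  · rintro _ ⟨t, rfl⟩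
    exact h0 _
  · filter_upwards [eventually_ge_atTop T] with t ht
    rw [max_eq_left ht]

/-- A motion obeying the sliding dynamics from some time on converges to the origin. -/
theorem HasAcceleration.tendsto_zero {x g : ℝ → ℝ} {α c k T : ℝ} (h : HasAcceleration x g)
    (hα₀ : 0 < α) (hα₁ : α < 1) (hc : 0 < c) (hk : 0 < k) (hT : 0 ≤ T)
    (hv : ∀ t, T < t → HasDerivAt (velocity x) (-k * x t - c * caputo α x t) t) :
    Tendsto x atTop (𝓝 0) := by
  set V := extVelocity x with hVdef
  set E := energy α c k x (infState V) with hE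
  have hV : Continuous V := h.continuous_extVelocity
  have hVv : ∀ t, 0 ≤ t → V t = velocity x t := fun t ht => extVelocity_of_nonneg x ht
  have hanti : AntitoneOn E (Ici T) := h.antitoneOn_energy hα₀ hα₁ hc hT hv
  have hge : ∀ t, 1 / 2 * k * x t ^ 2 + 1 / 2 * velocity x t ^ 2 ≤ E t :=
    energy_ge hα₀ hα₁ hc k x (infState V)
  have hE0 : ∀ t, 0 ≤ E t := fun t => le_trans (by positivity) (hge t)
  have hET : ∀ t, T ≤ t → E t ≤ E T := fun t ht => hanti (mem_Ici.2 le_rfl) (mem_Ici.2 ht) ht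
  -- The bounds must include [0, T], since x₂ and z remember the whole past; the energy controls
  -- only the tail.
  obtain ⟨X, hX0, hX⟩ := exists_abs_le_of_continuousOn_of_tail h.continuousOn (T := T)
    (C := √(2 * E T / k)) (fun t ht => Real.abs_le_sqrt (by
      rw [le_div_iff₀ hk]
      nlinarith [hge t, hET t ht, sq_nonneg (velocity x t)]))
  obtain ⟨M, hM0, hM⟩ := exists_abs_le_of_continuousOn_of_tail h.continuousOn_velocity (T := T)
    (C := √(2 * E T)) (fun t ht => Real.abs_le_sqrt (by
      nlinarith [hge t, hET t ht, mul_nonneg hk.le (sq_nonneg (x t))]))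
  set Y := (3 * X + M) * ∫ ω in Ioi (0 : ℝ), weight (1 - α) ω * min 1 (1 / ω)
  have hY : ∀ t, 0 ≤ t → |caputo α x t| ≤ Y := fun t ht =>
    h.abs_caputo_le hα₀ hα₁ ht (fun τ hτ => hX τ hτ.1) (fun τ hτ => hM τ hτ.1)
  have hZ : ∀ ω : ℝ, 0 < ω → ∀ t, 0 ≤ t → |infState V ω t| ≤ (3 * X + M) * min 1 (1 / ω) :=
    fun ω hω t ht => h.abs_infState_le hω ht (fun τ hτ => hX τ hτ.1) (fun τ hτ => hM τ hτ.1)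
  have hZ' : ∀ ω : ℝ, 0 < ω → ∀ t, 0 ≤ t → |infState V ω t| ≤ 3 * X + M := fun ω hω t ht =>
    (hZ ω hω t ht).trans (mul_le_of_le_one_right (by positivity) (min_le_left _ _))
  -- the dissipation is integrable in time
  obtain ⟨l, hl⟩ := tendsto_of_antitoneOn_of_nonneg hanti hE0
  have hD : IntegrableOn (dissipation α (infState V)) (Ioi T) := by
    have h1 : IntegrableOn (fun t => -c * dissipation α (infState V) t) (Ioi T) := by
      refine integrableOn_Ioi_deriv_of_nonpos
        ((h.continuousOn_energy hα₀ hα₁ T hT).mono (Ici_subset_Ici.2 hT))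
        (fun t ht => h.hasDerivAt_energy hα₀ hα₁ (hT.trans_lt ht) (hv t ht)) (fun t _ => ?_) hl
      nlinarith [dissipation_nonneg hα₀ hα₁ (infState V) t]
    refine (h1.const_mul (-c)⁻¹).congr (ae_of_all _ fun t => ?_)
    have : -c ≠ 0 := by linarith
    field_simp
  -- hence almost every frequency component is square integrable in time
  have hsq : ∀ᵐ ω ∂(volume.restrict (Ioi (0 : ℝ))),
      IntegrableOn (fun t => infState V ω t ^ 2) (Ioi T) := by
    have hF : Integrable (fun p : ℝ × ℝ => p.2 * weight (1 - α) p.2 * infState V p.2 p.1 ^ 2)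
        ((volume.restrict (Ioi T)).prod (volume.restrict (Ioi 0))) := by
      have hm1 := measurable_weight (1 - α)
      have hm2 : Measurable fun p : ℝ × ℝ => infState V p.2 p.1 :=
        ((continuous_infState hV).comp continuous_swap).measurable
      rw [integrable_prod_iff (Measurable.aestronglyMeasurable (by fun_prop))]
      constructor
      · filter_upwards [ae_restrict_mem measurableSet_Ioi] with t ht
        exact (integrableOn_infState hα₀ hα₁ hV (hT.trans (le_of_lt ht))).2.2
      · refine Integrable.congr hD (ae_of_all _ fun t => ?_)
        refine setIntegral_congr_fun measurableSet_Ioi fun ω hω => ?_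
        have := weight_pos hα₀ hα₁ hω
        have : 0 < ω := hω
        simp only
        rw [Real.norm_of_nonneg (by positivity)]
    filter_upwards [hF.prod_left_ae, ae_restrict_mem measurableSet_Ioi] with ω h1 hω
    have hw := (weight_pos hα₀ hα₁ hω).ne'
    have hω' : ω ≠ 0 := (mem_Ioi.1 hω).ne'
    refine (h1.const_mul (ω * weight (1 - α) ω)⁻¹).congr (ae_of_all _ fun t => ?_)
    simp only
    field_simp
  have hlim : ∀ᵐ ω ∂(volume.restrict (Ioi (0 : ℝ))), Tendsto (infState V ω) atTop (𝓝 0) := by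
    filter_upwards [hsq, ae_restrict_mem measurableSet_Ioi] with ω h1 hω
    have hω' : 0 < ω := hω
    have hc := (continuous_iff_continuousAt.2 fun t => (hasDerivAt_infState hV ω t).continuousAt)
    have hc2 : Continuous fun t => infState V ω t ^ 2 := hc.pow 2
    -- Barbalat applied to the convergent primitive of z²; the Lipschitz constant bounds 2|z| |z'|.
    have h2 : Tendsto (fun t => infState V ω t ^ 2) atTop (𝓝 0) := by
      refine tendsto_zero_of_hasDerivAt_add (T := T) (r := fun _ => 0)
        (K := 2 * (3 * X + M) * (ω * (3 * X + M) + M)) (by positivity)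
        (intervalIntegral_tendsto_integral_Ioi T h1 tendsto_id)
        (fun t _ => ?_) (fun s t hs hst => ?_) tendsto_const_nhds
      · rw [add_zero]
        exact (hc2.integral_hasStrictDerivAt T t).hasDerivAt
      · refine abs_sub_le_of_hasDerivAt (fun t _ => (hasDerivAt_infState hV ω t).pow 2)
          (fun t ht => ?_) hs hst
        have ht0 : 0 ≤ t := hT.trans ht.le
        have b := hZ' ω hω' t ht0
        have bv : |V t| ≤ M := by rw [hVv t ht0]; exact hM t ht0
        rw [abs_mul]
        refine mul_le_mul ?_ ?_ (abs_nonneg _) (by positivity)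
        · simp only [Nat.cast_ofNat, Nat.add_one_sub_one, pow_one, abs_mul, abs_two]
          gcongr
        · refine (abs_add_le _ _).trans (add_le_add ?_ bv)
          rw [abs_mul, abs_neg, abs_of_pos hω']
          gcongr
    have h3 := h2.sqrt
    simp only [Real.sqrt_sq_eq_abs, Real.sqrt_zero] at h3
    exact (tendsto_zero_iff_abs_tendsto_zero _).2 h3
  -- the velocity tends to zero
  have hvlim : Tendsto (velocity x) atTop (𝓝 0) := by
    have hne : (ae (volume.restrict (Ioi (0 : ℝ)))).NeBot := by
      rw [ae_neBot, Ne, Measure.restrict_eq_zero, Real.volume_Ioi]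
      exact ENNReal.top_ne_zero
    -- A single frequency suffices: z(ω, ·) → 0 and z' = x' - ωz, with x' Lipschitz because the
    -- acceleration is bounded.
    obtain ⟨ω, h1, hω⟩ := (hlim.and (ae_restrict_mem measurableSet_Ioi)).exists
    refine tendsto_zero_of_hasDerivAt_add (T := T) (r := fun t => -ω * infState V ω t)
      (K := k * X + c * Y) ?_ h1 (fun t ht => ?_) (fun s t hs hst => ?_) ?_
    · have := (abs_nonneg _).trans (hY 0 le_rfl)
      positivity
    · rw [add_comm, ← hVv t (hT.trans ht.le)]
      exact hasDerivAt_infState hV ω t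
    · refine abs_sub_le_of_hasDerivAt hv (fun t ht => ?_) hs hst
      refine (abs_sub _ _).trans ?_
      rw [abs_mul, abs_mul, abs_neg, abs_of_pos hk, abs_of_pos hc]
      have := hX t (hT.trans ht.le)
      have := hY t (hT.trans ht.le)
      gcongr
    · simpa using h1.const_mul (-ω)
  -- the fractional derivative tends to zero
  have hylim : Tendsto (caputo α x) atTop (𝓝 0) := by
    have h1 : Tendsto (fun t => ∫ ω in Ioi (0 : ℝ), weight (1 - α) ω * infState V ω t) atTop
        (𝓝 (∫ _ω in Ioi (0 : ℝ), (0 : ℝ))) := by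
      refine tendsto_integral_filter_of_dominated_convergence
        (fun ω => (3 * X + M) * (weight (1 - α) ω * min 1 (1 / ω))) ?_ ?_
        ((integrableOn_weight_mul_min hα₀ hα₁).const_mul _) ?_
      · exact Eventually.of_forall fun t => (measurable_weight _).aestronglyMeasurable.mul
          (continuous_infState_left hV t).aestronglyMeasurable
      · filter_upwards [eventually_ge_atTop 0] with t ht
        filter_upwards [ae_restrict_mem measurableSet_Ioi] with ω hω
        exact abs_weight_mul_le hα₀ hα₁ hω (hZ ω hω t ht)
      · filter_upwards [hlim] with ω hω
        simpa using hω.const_mul (weight (1 - α) ω)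
    rw [integral_zero] at h1
    refine h1.congr' ?_
    filter_upwards [eventually_ge_atTop 0] with t ht
    exact (h.caputo_eq_integral_weight hα₀ hα₁ ht).symm
  -- the position tends to zero
  have hxlim : Tendsto (fun t => -k * x t) atTop (𝓝 0) := by
    refine tendsto_zero_of_hasDerivAt_add (T := T) (r := fun t => -c * caputo α x t)
      (K := k * M) (by positivity) hvlim (fun t ht => ?_) (fun s t hs hst => ?_) ?_
    · refine (hv t ht).congr_deriv ?_
      ring
    · refine abs_sub_le_of_hasDerivAt (fun t ht =>
        (h.hasDerivAt (hT.trans_lt ht)).const_mul (-k)) (fun t ht => ?_) hs hst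
      rw [abs_mul, abs_neg, abs_of_pos hk]
      have := hM t (hT.trans ht.le)
      gcongr
    · simpa using hylim.const_mul (-c)
  have h4 := hxlim.const_mul (-k)⁻¹
  rw [mul_zero] at h4
  refine h4.congr fun t => ?_
  have : -k ≠ 0 := by linarith
  field_simp

/-! ### The controlled oscillator -/

theorem hasDerivAt_integral_of_continuousOn {f : ℝ → ℝ} (hf : ContinuousOn f (Ici 0)) {t : ℝ}
    (ht : 0 < t) : HasDerivAt (fun t => ∫ τ in (0 : ℝ)..t, f τ) (f t) t := by
  have hc : Continuous fun s => f (max s 0) :=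
    hf.comp_continuous (by fun_prop) fun _ => mem_Ici.2 (le_max_right _ _)
  have h1 := (hc.integral_hasStrictDerivAt 0 t).hasDerivAt
  rw [max_eq_left ht.le] at h1
  refine h1.congr_of_eventuallyEq ?_
  filter_upwards [Ioi_mem_nhds ht] with s hs
  refine intervalIntegral.integral_congr fun τ hτ => ?_
  rw [uIcc_of_le (le_of_lt hs)] at hτ
  simp only [max_eq_left hτ.1]

theorem absolutelyContinuousOnInterval_integral {f : ℝ → ℝ} (hf : ContinuousOn f (Ici 0)) {T : ℝ}
    (hT : 0 ≤ T) : AbsolutelyContinuousOnInterval (fun t => ∫ τ in (0 : ℝ)..t, f τ) 0 T := by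
  refine IntervalIntegrable.absolutelyContinuousOnInterval_intervalIntegral (c := 0) ?_
    left_mem_uIcc
  refine (hf.mono ?_).intervalIntegrable
  rw [uIcc_of_le hT]
  exact fun s hs => hs.1

theorem sub_le_of_ae_deriv_le {f : ℝ → ℝ} (hf : ∀ T, 0 ≤ T → AbsolutelyContinuousOnInterval f 0 T)
    {p q C : ℝ} (hp : 0 ≤ p) (hpq : p ≤ q)
    (hd : ∀ᵐ t ∂(volume.restrict (Ici (0 : ℝ))), deriv f t ≤ C) : f q - f p ≤ C * (q - p) := by
  have hac : AbsolutelyContinuousOnInterval f p q := (hf q (hp.trans hpq)).mono (by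
    rw [uIcc_of_le hpq, uIcc_of_le (hp.trans hpq)]
    exact Icc_subset_Icc_left hp)
  rw [← hac.integral_deriv_eq_sub]
  have : ∫ _ in p..q, C = C * (q - p) := by
    rw [intervalIntegral.integral_const, smul_eq_mul, mul_comm]
  rw [← this]
  refine intervalIntegral.integral_mono_ae_restrict hpq hac.intervalIntegrable_deriv
    intervalIntegrable_const ?_
  exact ae_restrict_of_ae_restrict_of_subset (fun s hs => hp.trans hs.1) hd

/-- A locally absolutely continuous function that decreases at a definite rate while positive
reaches zero in finite time. -/
theorem exists_eq_zero_of_ae_deriv_le {f : ℝ → ℝ}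
    (hf : ∀ T, 0 ≤ T → AbsolutelyContinuousOnInterval f 0 T) {ρ : ℝ} (hρ : 0 < ρ) (h0 : 0 ≤ f 0)
    (hd : ∀ᵐ t ∂(volume.restrict (Ici (0 : ℝ))), 0 < f t → deriv f t ≤ -ρ) :
    ∃ T, 0 ≤ T ∧ f T = 0 := by
  by_contra! hne
  have hpos : ∀ t, 0 ≤ t → 0 < f t := by
    intro t ht
    by_contra! hle
    obtain ⟨s, hs, h⟩ := intermediate_value_Icc' ht
      ((continuousOn_Ici_of_absolutelyContinuous hf).mono fun s hs => hs.1) ⟨hle, h0⟩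
    exact hne s hs.1 h
  -- Descent at rate ρ from f(0) would exhaust f by the time f(0)/ρ.
  have ht : 0 ≤ f 0 / ρ := by positivity
  have h1 := sub_le_of_ae_deriv_le hf le_rfl ht (C := -ρ) (by
    filter_upwards [hd, ae_restrict_mem measurableSet_Ici] with t h hm using h (hpos t hm))
  have h2 := hpos _ ht
  have h3 : -ρ * (f 0 / ρ - 0) = -f 0 := by field_simp; ring
  linarith

/-- The gain F absorbs s f ≤ F|s|, leaving ρ₁/√2 as margin. At s = 0 both sides vanish, so the
set-valued choice of σ is harmless. -/
theorem mul_switching_le {s f v σ F ρ₁ ρ₂ : ℝ} (hf : |f| ≤ F)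
    (hσ : σ ∈ filippovSign s) (hv : v = -(F + ρ₁ / √2) * σ - ρ₂ * s) :
    s * (f + v) ≤ -(ρ₁ / √2) * |s| - ρ₂ * s ^ 2 := by
  obtain ⟨h1, h2⟩ := abs_le.1 hf
  subst hv
  rcases lt_trichotomy s 0 with h | h | h
  · have : σ = -1 := by simpa [filippovSign, h, h.not_gt] using hσ
    subst this
    rw [abs_of_neg h]
    nlinarith
  · simp [h]
  · have : σ = 1 := by simpa [filippovSign, h] using hσ
    subst this
    rw [abs_of_pos h]
    nlinarith

theorem sqrt_reachingEnergy (α c k : ℝ) (x : ℝ → ℝ) (t : ℝ) :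
    √(reachingEnergy α c k x t) = |slidingVar α c k x t| / √2 := by
  rw [reachingEnergy, Real.sqrt_mul (by norm_num), Real.sqrt_sq_eq_abs, one_div, Real.sqrt_inv]
  ring

namespace HasAcceleration

variable {x g : ℝ → ℝ} {α : ℝ}

theorem slidingVar_ac (h : HasAcceleration x g) (hα₁ : α < 1) (c k : ℝ) {T : ℝ} (hT : 0 ≤ T) :
    AbsolutelyContinuousOnInterval (slidingVar α c k x) 0 T :=
  ((h.velocity_ac T hT).add
    ((absolutelyContinuousOnInterval_integral h.continuousOn hT).const_mul k)).add
    ((absolutelyContinuousOnInterval_integral (h.continuousOn_caputo hα₁) hT).const_mul c)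

theorem hasDerivAt_slidingVar (h : HasAcceleration x g) (hα₁ : α < 1) (c k : ℝ) :
    ∀ᵐ t ∂(volume.restrict (Ici (0 : ℝ))), 0 < t ∧ HasDerivAt (slidingVar α c k x)
      (deriv (velocity x) t + k * x t + c * caputo α x t) t := by
  have hpos : ∀ᵐ t ∂(volume.restrict (Ici (0 : ℝ))), 0 < t := by
    rw [← restrict_Ioi_eq_restrict_Ici]
    exact ae_restrict_mem measurableSet_Ioi
  filter_upwards [h.acceleration, hpos] with t ht ht0
  exact ⟨ht0, (ht.differentiableAt.hasDerivAt.add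
    ((hasDerivAt_integral_of_continuousOn h.continuousOn ht0).const_mul k)).add
    ((hasDerivAt_integral_of_continuousOn (h.continuousOn_caputo hα₁) ht0).const_mul c)⟩

/-- Away from 0, |s| decreases at rate at least ρ, so s hits 0; s² cannot increase, so s stays
there. Constancy of s is then the sliding equation. -/
theorem tendsto_of_reaching (h : HasAcceleration x g) {c k ρ : ℝ} (hα₀ : 0 < α) (hα₁ : α < 1)
    (hc : 0 < c) (hk : 0 < k) (hρ : 0 < ρ)
    (hs : ∀ᵐ t ∂(volume.restrict (Ici (0 : ℝ))),
      slidingVar α c k x t * deriv (slidingVar α c k x) t ≤ -ρ * |slidingVar α c k x t|) :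
    Tendsto (slidingVar α c k x) atTop (𝓝 0) ∧ Tendsto x atTop (𝓝 0) := by
  set s := slidingVar α c k x with hsdef
  have hac : ∀ T, 0 ≤ T → AbsolutelyContinuousOnInterval s 0 T :=
    fun T hT => h.slidingVar_ac hα₁ c k hT
  have hsd := h.hasDerivAt_slidingVar hα₁ c k
  obtain ⟨T, hT, hsT⟩ : ∃ T, 0 ≤ T ∧ s T = 0 := by
    rcases le_total 0 (s 0) with h0 | h0
    · refine exists_eq_zero_of_ae_deriv_le hac hρ h0 ?_
      filter_upwards [hs] with t ht hp
      rw [abs_of_pos hp] at ht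
      nlinarith
    · obtain ⟨T, hT, h1⟩ := exists_eq_zero_of_ae_deriv_le (f := fun t => -s t)
        (fun T hT => (hac T hT).neg) hρ (by linarith) (by
          filter_upwards [hs] with t ht hp
          have hp' : s t < 0 := by linarith
          rw [abs_of_neg hp'] at ht
          rw [deriv.fun_neg]
          nlinarith)
      exact ⟨T, hT, by linarith⟩
  have hzero : ∀ t, T ≤ t → s t = 0 := by
    intro t ht
    have h1 := sub_le_of_ae_deriv_le (f := fun t => s t * s t) (C := 0)
      (fun T hT => (hac T hT).fun_mul (hac T hT)) hT ht (by
        filter_upwards [hs, hsd] with t ht h2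
        have h3 := h2.2.differentiableAt.hasDerivAt
        rw [(h3.fun_mul h3).deriv]
        nlinarith [abs_nonneg (s t)])
    simp only [hsT, mul_zero, zero_mul, sub_zero] at h1
    nlinarith [mul_self_nonneg (s t)]
  refine ⟨?_, ?_⟩
  · refine tendsto_const_nhds.congr' ?_
    filter_upwards [eventually_ge_atTop T] with t ht using (hzero t ht).symm
  · refine h.tendsto_zero hα₀ hα₁ hc hk hT fun t ht => ?_
    refine h.hasDerivAt_velocity hT (IsSlidingMotion.continuousOn_acceleration h hα₁) ?_ ht
    -- After T the derivative of s computed from its definition must equal 0, which reads x'' = -kx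
    -- - c x₂.
    filter_upwards [hsd] with t h1 htT
    have h2 : HasDerivAt s 0 t := by
      refine (hasDerivAt_const t (0 : ℝ)).congr_of_eventuallyEq ?_
      filter_upwards [Ioi_mem_nhds htT] with r hr using hzero r (le_of_lt hr)
    have := h1.2.unique h2
    linarith

end HasAcceleration

theorem duffing_controlled (α a b c k F ρ₁ ρ₂ : ℝ) (hα₀ : 0 < α) (hα₁ : α < 1)
    (hc : 0 < c) (hk : 0 < k) (hρ₁ : 0 < ρ₁) (hρ₂ : 0 < ρ₂) {f v x : ℝ → ℝ}
    (hf : ∀ t : ℝ, 0 ≤ t → |f t| ≤ F)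
    (h : IsDuffingMotion α a b c f (fun t => b * x t ^ 3 + (a - k) * x t + v t) x)
    (hv : IsSwitchingControl F ρ₁ ρ₂ (slidingVar α c k x) v) :
    (∀ᵐ t ∂(volume.restrict (Ici (0 : ℝ))),
      HasDerivAt (slidingVar α c k x)
        (deriv (velocity x) t + k * x t + c * caputo α x t) t ∧
      deriv (velocity x) t + k * x t + c * caputo α x t = f t + v t ∧
      HasDerivAt (reachingEnergy α c k x) (slidingVar α c k x t * (f t + v t)) t ∧
      slidingVar α c k x t * (f t + v t) ≤
        -ρ₁ * √(reachingEnergy α c k x t) - 2 * ρ₂ * reachingEnergy α c k x t) ∧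
    Tendsto (slidingVar α c k x) atTop (𝓝 0) ∧ Tendsto x atTop (𝓝 0) := by
  have ha : HasAcceleration x _ := h
  have hsd := ha.hasDerivAt_slidingVar hα₁ c k
  have heq : ∀ᵐ t ∂(volume.restrict (Ici (0 : ℝ))),
      deriv (velocity x) t + k * x t + c * caputo α x t = f t + v t := by
    filter_upwards [ha.deriv_velocity] with t ht
    -- Substituting the feedback cancels the cubic term and replaces the stiffness a by k, leaving
    -- only f + v.
    rw [ht]
    ring
  have hle : ∀ᵐ t ∂(volume.restrict (Ici (0 : ℝ))), slidingVar α c k x t * (f t + v t) ≤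
      -(ρ₁ / √2) * |slidingVar α c k x t| - ρ₂ * slidingVar α c k x t ^ 2 := by
    filter_upwards [hv, ae_restrict_mem measurableSet_Ici] with t ht ht0
    obtain ⟨σ, hσ, e⟩ := ht
    exact mul_switching_le (hf t ht0) hσ e
  refine ⟨?_, ha.tendsto_of_reaching hα₀ hα₁ hc hk (ρ := ρ₁ / √2) (by positivity) ?_⟩
  · filter_upwards [hsd, heq, hle] with t h1 h2 h3
    refine ⟨h1.2, h2, ?_, ?_⟩
    · rw [← h2]
      refine ((h1.2.pow 2).const_mul (1 / 2)).congr_deriv ?_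
      simp only [Nat.cast_ofNat, Nat.add_one_sub_one, pow_one]
      ring
    · rw [sqrt_reachingEnergy, reachingEnergy]
      refine h3.trans (le_of_eq ?_)
      ring
  · filter_upwards [hsd, heq, hle] with t h1 h2 h3
    rw [h1.2.deriv, h2]
    nlinarith [mul_nonneg hρ₂.le (sq_nonneg (slidingVar α c k x t))]

end FracDuffing

theorem mainTheorem5 (α a b c k F ρ₁ ρ₂ : ℝ) (hα₀ : 0 < α) (hα₁ : α < 1)
    (hc : 0 < c) (hk : 0 < k) (hρ₁ : 0 < ρ₁) (hρ₂ : 0 < ρ₂) :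
    -- the sliding dynamics: state equations, energy balance for the diffusive energy
    (∀ x : ℝ → ℝ, FracDuffing.IsSlidingMotion α c k x →
      (∀ t : ℝ, 0 < t →
        FracDuffing.caputo (1 - α) (FracDuffing.caputo α x) t = FracDuffing.velocity x t) ∧
      (∃ z : ℝ → ℝ → ℝ, FracDuffing.IsInfiniteState x z) ∧
      ∀ z : ℝ → ℝ → ℝ, FracDuffing.IsInfiniteState x z →
        (∀ t : ℝ, 0 ≤ t →
          IntegrableOn (fun ω => FracDuffing.weight (1 - α) ω * z ω t) (Ioi 0) ∧
          FracDuffing.caputo α x t =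
            ∫ ω in Ioi (0 : ℝ), FracDuffing.weight (1 - α) ω * z ω t) ∧
        (∀ t : ℝ, 0 ≤ t →
          IntegrableOn (fun ω => FracDuffing.weight (1 - α) ω * z ω t ^ 2) (Ioi 0) ∧
          IntegrableOn (fun ω => ω * FracDuffing.weight (1 - α) ω * z ω t ^ 2) (Ioi 0)) ∧
        (∀ t : ℝ, 0 < t →
          HasDerivAt (FracDuffing.energy α c k x z) (-c * FracDuffing.dissipation α z t) t) ∧
        (x 0 ≠ 0 ∨ FracDuffing.velocity x 0 ≠ 0 →
          ∀ t : ℝ, 0 < t → -c * FracDuffing.dissipation α z t < 0)) ∧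
    -- the sliding dynamics: Lyapunov stability and convergence
    (∀ ε : ℝ, 0 < ε → ∃ δ : ℝ, 0 < δ ∧
      ∀ x : ℝ → ℝ, FracDuffing.IsSlidingMotion α c k x →
        |x 0| < δ → |FracDuffing.velocity x 0| < δ →
          ∀ t : ℝ, 0 ≤ t →
            |x t| < ε ∧ |FracDuffing.caputo α x t| < ε ∧ |FracDuffing.velocity x t| < ε) ∧
    (∀ x : ℝ → ℝ, FracDuffing.IsSlidingMotion α c k x → Tendsto x atTop (𝓝 0)) ∧
    -- the controlled oscillator
    (∀ f v x : ℝ → ℝ, (∀ t : ℝ, 0 ≤ t → |f t| ≤ F) →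
      FracDuffing.IsDuffingMotion α a b c f
        (fun t => b * x t ^ 3 + (a - k) * x t + v t) x →
      FracDuffing.IsSwitchingControl F ρ₁ ρ₂ (FracDuffing.slidingVar α c k x) v →
      (∀ t : ℝ, 0 < t →
        FracDuffing.caputo (1 - α) (FracDuffing.caputo α x) t = FracDuffing.velocity x t) ∧
      (∀ T : ℝ, 0 ≤ T →
        AbsolutelyContinuousOnInterval (FracDuffing.slidingVar α c k x) 0 T) ∧
      (∀ᵐ t ∂(volume.restrict (Ici (0 : ℝ))),
        HasDerivAt (FracDuffing.slidingVar α c k x)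
          (deriv (FracDuffing.velocity x) t + k * x t + c * FracDuffing.caputo α x t) t ∧
        deriv (FracDuffing.velocity x) t + k * x t + c * FracDuffing.caputo α x t = f t + v t ∧
        HasDerivAt (FracDuffing.reachingEnergy α c k x)
          (FracDuffing.slidingVar α c k x t * (f t + v t)) t ∧
        FracDuffing.slidingVar α c k x t * (f t + v t) ≤
          -ρ₁ * √(FracDuffing.reachingEnergy α c k x t)
            - 2 * ρ₂ * FracDuffing.reachingEnergy α c k x t) ∧
      Tendsto (FracDuffing.slidingVar α c k x) atTop (𝓝 0) ∧
      Tendsto x atTop (𝓝 0)) := by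
  refine ⟨fun x h => ⟨fun t ht => FracDuffing.HasAcceleration.caputo_caputo h hα₀ hα₁ ht,
      ⟨_, FracDuffing.HasAcceleration.isInfiniteState h⟩,
      fun z hz => FracDuffing.IsSlidingMotion.energy_balance h hα₀ hα₁ hc hk hz⟩,
    fun ε hε => FracDuffing.sliding_stable hα₀ hα₁ hc hk hε, fun x h => ?_,
    fun f v x hf h hv => ?_⟩
  · exact FracDuffing.HasAcceleration.tendsto_zero h hα₀ hα₁ hc hk le_rfl
      fun t ht => FracDuffing.IsSlidingMotion.hasDerivAt_velocity h hα₁ ht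
  · exact ⟨fun t ht => FracDuffing.HasAcceleration.caputo_caputo h hα₀ hα₁ ht,
      fun T hT => FracDuffing.HasAcceleration.slidingVar_ac h hα₁ c k hT,
      FracDuffing.duffing_controlled α a b c k F ρ₁ ρ₂ hα₀ hα₁ hc hk hρ₁ hρ₂ hf h hv⟩
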